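/- Notation. Let $\mathrm{OPol}_N=\mathbb Z\langle x_1,\dots,x_N\rangle/(x_ix_j+x_jx_i : i\ne j)$, $\tilde x_i=(-1)^{i-1}x_i$. For a partition $\kappa$ (drawn as a Young diagram, row 1 on top) let $N(\kappa)$ be the sum over the boxes $B$ of $\kappa$ of the number of boxes in rows above $B$, and $dN(\kappa)$ the sum over the boxes $B$ of the number of boxes above $B$ in the same column. The odd Schur function $s_\kappa\in\varprojlim_N\mathrm{OPol}_N\subset\prod_N \mathrm{OPol}_N$ has as its component in $\mathrm{OPol}_N$ $$s_\kappa=(-1)^{dN(\kappa)+N(\kappa)}\sum_T \tilde x_{w_1}\tilde x_{w_2}\cdots\tilde x_{w_r},$$ the sum over semistandard tableaux $T$ of shape $\kappa$ with entries in $\{1,\dots,N\}$, where $w_1w_2\cdots w_r$ is the row word of $T$ (rows read left to right, from the bottom row to the top row). The odd Schur functions are linearly independent over $\mathbb Z$, and the odd Littlewood–Richardson coefficients $c_{\mu\nu}^\lambda\in\mathbb Z$ are well defined by the finite expansions $s_\mu s_\nu=\sum_\lambda c_{\mu\nu}^\lambda s_\lambda$. Fix $n\ge1$. A triangle is a real array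 $A=(a_{i,j})_{0\le i\le j\le n}$; it is an integer point if all $a_{i,j}\in\mathbb Z$. For partitions $\lambda,\mu,\nu$ with at most $n$ parts, let $\bigtriangleup_{LR}(\lambda,\mu,\nu)$ be the set of triangles with (i) $a_{0,0}=0$; (ii) $a_{i,j}\ge0$ for $1\le i<j\le n$; (iii) $\sum_{p=0}^{i-1}a_{p,j}\ge\sum_{p=0}^{i}a_{p,j+1}$ for $1\le i\le j<n$; (iv) $\sum_{q=i}^{j}a_{i,q}\ge\sum_{q=i+1}^{j+1}a_{i+1,q}$ for $1\le i\le j<n$; (v) $\lambda_j=\sum_{p=0}^ja_{p,j}$, $\mu_j=a_{0,j}$, $\nu_j=\sum_{q=j}^na_{j,q}$ for $1\le j\le n$. Let $\mathfrak H(\lambda,\mu,\nu)$ be the set of hives with boundary given by $\lambda,\mu,\nu$, i.e. triangles $H=(h_{i,j})$ with (i) $h_{0,0}=0$; (ii) $h_{i,j}-h_{i,j-1}\ge h_{i-1,j}-h_{i-1,j-1}$ for $1\le i<j\le n$; (iii) $h_{i-1,j}-h_{i-1,j-1}\ge h_{i,j+1}-h_{i,j}$ for $1\le i\le j<n$; (iv)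 $h_{i,j}-h_{i-1,j}\ge h_{i+1,j+1}-h_{i,j+1}$ for $1\le i\le j<n$; (v) $\lambda_j=h_{j,j}-h_{j-1,j-1}$, $\mu_j=h_{0,j}-h_{0,j-1}$, $\nu_j=h_{j,n}-h_{j-1,n}$ for $1\le j\le n$ (entries with $i>j$ are read as $0$). Put $$Q_\bigtriangleup(A)=\sum_{i=0}^n\sum_{j=i}^n a_{i,j}\sum_{p=0}^{i-1}\sum_{q=p}^{j-1}a_{p,q},$$ $$Q_{\mathfrak H}(H)=\sum_{i=1}^n\sum_{j=i}^n h_{i-1,j-1}\left(h_{i,j}-h_{i-1,j}-h_{i,j-1}+h_{i-1,j-1}\right)-\sum_{i=1}^{n-1}h_{i,i}^2 .$$ Theorem. Let $n\ge 1$ and let $\lambda,\mu,\nu$ be partitions with at most $n$ parts. Then $\bigtriangleup_{LR}(\lambda,\mu,\nu)$ and $\mathfrak H(\lambda,\mu,\nu)$ have finitely many integer points, and $$c_{\mu\nu}^\lambda=(-1)^{N(\mu)+N(\lambda)}\sum_{A\in\bigtriangleup_{LR}(\lambda,\mu,\nu)\text{ integer}}(-1)^{Q_\bigtriangleup(A)}=(-1)^{N(\mu)+N(\lambda)}\sum_{H\in\mathfrak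 H(\lambda,\mu,\nu)\text{ integer}}(-1)^{Q_{\mathfrak H}(H)}.$$ Moreover the linear map $\Phi$, $h_{i,j}=\sum_{p=0}^i\sum_{q=p}^ja_{p,q}$, restricts to a bijection $\bigtriangleup_{LR}(\lambda,\mu,\nu)\to\mathfrak H(\lambda,\mu,\nu)$ and to a bijection between the integer points of these sets, and $Q_{\mathfrak H}(\Phi(A))=Q_\bigtriangleup(A)$ for every triangle $A$ with $a_{0,0}=0$. -/

import Mathlib

namespace OddLR

/-! ### Odd (skew) polynomials -/

/-- The relations `x_i x_j = - x_j x_i` for `i ≠ j`. -/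
inductive SkewRel (N : ℕ) : FreeAlgebra ℤ (Fin N) → FreeAlgebra ℤ (Fin N) → Prop
  | anticomm (i j : Fin N) (h : i ≠ j) :
      SkewRel N (FreeAlgebra.ι ℤ i * FreeAlgebra.ι ℤ j)
        (-(FreeAlgebra.ι ℤ j * FreeAlgebra.ι ℤ i))

/-- The ring `OPol_N` of skew polynomials in the variables `x_0, …, x_{N-1}`. -/
abbrev OPol (N : ℕ) : Type := RingQuot (SkewRel N)

/-- The signed variable `(-1)^k x_k` of `OPol_N` (the variables are numbered from `0`);
it is `0` for `k ≥ N`, in accordance with the projections `OPol_{N+1} → OPol_N`, which send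
the last variable to `0`. -/
noncomputable def xTilde (N k : ℕ) : OPol N :=
  if h : k < N then (-1) ^ k * RingQuot.mkRingHom (SkewRel N) (FreeAlgebra.ι ℤ ⟨k, h⟩) else 0

/-! ### Young diagrams, tableaux and odd Schur functions

Rows and columns of a Young diagram are numbered from `0`; row `i` is below row `i'` if `i' < i`. -/

/-- `N(κ)`: for each box of `κ`, count the boxes in the rows above it. -/
def northCount (κ : YoungDiagram) : ℕ :=
  ∑ b ∈ κ.cells, (κ.cells.filter fun b' => b'.1 < b.1).card

/-- `dN(κ)`: for each box of `κ`, count the boxes above it in the same column. -/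
def directNorthCount (κ : YoungDiagram) : ℕ :=
  ∑ b ∈ κ.cells, (κ.cells.filter fun b' => b'.1 < b.1 ∧ b'.2 = b.2).card

/-- The row word of a tableau: its rows from bottom to top, each read from left to right. -/
def rowWord {κ : YoungDiagram} (T : SemistandardYoungTableau κ) : List ℕ :=
  (List.range (κ.colLen 0)).reverse.flatMap fun i => (List.range (κ.rowLen i)).map fun j => T i j

/-- The semistandard tableaux of shape `κ` with entries in the alphabet `{0, …, N-1}`. -/
def boundedSSYT (κ : YoungDiagram) (N : ℕ) : Set (SemistandardYoungTableau κ) :=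
  {T | ∀ i j, (i, j) ∈ κ → T i j < N}

theorem finite_boundedSSYT (κ : YoungDiagram) (N : ℕ) : (boundedSSYT κ N).Finite := by
  let f : boundedSSYT κ N → (κ.cells → Fin N) := fun T b =>
    ⟨T.1 b.1.1 b.1.2, T.2 _ _ ((YoungDiagram.mem_cells _).1 b.2)⟩
  have hf : Function.Injective f := by
    intro S T h
    apply Subtype.ext
    apply SemistandardYoungTableau.ext
    intro i j
    by_cases hb : (i, j) ∈ κ
    · exact congrArg Fin.val (congrFun h ⟨(i, j), (YoungDiagram.mem_cells _).2 hb⟩)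
    · rw [S.1.zeros hb, T.1.zeros hb]
  exact @Set.toFinite _ _ (Finite.of_injective f hf)

/-- The monomial attached to a word `w_1 ⋯ w_r`, the product of the signed variables
in `OPol_N`. -/
noncomputable def wordMonomial (N : ℕ) (w : List ℕ) : OPol N :=
  (w.map (xTilde N)).prod

/-- The (plactic) odd Schur polynomial `s_κ ∈ OPol_N`. The sum is over a finite set, by
`finite_boundedSSYT`. -/
noncomputable def oddSchurPoly (N : ℕ) (κ : YoungDiagram) : OPol N :=
  (-1) ^ (directNorthCount κ + northCount κ) * ∑ᶠ T ∈ boundedSSYT κ N, wordMonomial N (rowWord T)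

/-- The odd Schur function `s_κ`: the family of the odd Schur polynomials in `N = 0, 1, 2, …`
variables. The ring of odd symmetric functions, being the inverse limit of its versions in
finitely many variables, is a subring of the product ring `∏_N OPol_N`, and `s_κ` is
an element of it. -/
noncomputable def oddSchur (κ : YoungDiagram) : (N : ℕ) → OPol N :=
  fun N => oddSchurPoly N κ

open Classical in
/-- The coefficients of the expansion `s_μ s_ν = ∑_κ c_{μν}^κ s_κ` of a product in the odd Schur
functions. (The expansion exists, and is unique because the odd Schur functions are linearly
independent.) -/
noncomputable def oddLRExpansion (μ ν : YoungDiagram) : YoungDiagram →₀ ℤ :=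
  if h : ∃ c : YoungDiagram →₀ ℤ,
      oddSchur μ * oddSchur ν = Finsupp.linearCombination ℤ oddSchur c then h.choose else 0

/-- The odd Littlewood–Richardson coefficient `c_{μν}^κ`. -/
noncomputable def oddLRCoeff (μ ν κ : YoungDiagram) : ℤ := oddLRExpansion μ ν κ

/-! ### Triangles -/

/-- Triangles `(a_{i,j})`, `0 ≤ i ≤ j ≤ n`, with entries in `R`. -/
abbrev Triangle (n : ℕ) (R : Type*) : Type _ := {p : ℕ × ℕ // p.1 ≤ p.2 ∧ p.2 ≤ n} → R

/-- The entry of a triangle at `(i, j)`, which is `0` by convention outside `0 ≤ i ≤ j ≤ n`. -/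
def Triangle.at {n : ℕ} {R : Type*} [Zero R] (A : Triangle n R) (i j : ℕ) : R :=
  if h : i ≤ j ∧ j ≤ n then A ⟨(i, j), h⟩ else 0

/-- The part `κ_i` of a partition, where `i = 1, 2, …`. -/
def part (κ : YoungDiagram) (i : ℕ) : ℕ := κ.rowLen (i - 1)

/-- Littlewood–Richardson triangles. -/
structure IsLRTriangle {n : ℕ} (A : Triangle n ℝ) : Prop where
  apex : A.at 0 0 = 0
  nonneg : ∀ i j, 1 ≤ i → i < j → j ≤ n → 0 ≤ A.at i j
  column_strict : ∀ i j, 1 ≤ i → i ≤ j → j < n →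
    ∑ p ∈ Finset.range (i + 1), A.at p (j + 1) ≤ ∑ p ∈ Finset.range i, A.at p j
  yamanouchi : ∀ i j, 1 ≤ i → i ≤ j → j < n →
    ∑ q ∈ Finset.Icc (i + 1) (j + 1), A.at (i + 1) q ≤ ∑ q ∈ Finset.Icc i j, A.at i q

/-- The polytope of Littlewood–Richardson triangles with prescribed partitions `lam, μ, ν`. -/
def lrPolytope (n : ℕ) (lam μ ν : YoungDiagram) : Set (Triangle n ℝ) :=
  {A | IsLRTriangle A ∧
    (∀ j, 1 ≤ j → j ≤ n → (part lam j : ℝ) = ∑ p ∈ Finset.range (j + 1), A.at p j) ∧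
    (∀ j, 1 ≤ j → j ≤ n → (part μ j : ℝ) = A.at 0 j) ∧
    (∀ i, 1 ≤ i → i ≤ n → (part ν i : ℝ) = ∑ q ∈ Finset.Icc i n, A.at i q)}

/-- Hives, given by the right-slanted, vertical and left-slanted rhombus inequalities. -/
structure IsHive {n : ℕ} (H : Triangle n ℝ) : Prop where
  apex : H.at 0 0 = 0
  right : ∀ i j, 1 ≤ i → i < j → j ≤ n →
    H.at (i - 1) j - H.at (i - 1) (j - 1) ≤ H.at i j - H.at i (j - 1)
  vertical : ∀ i j, 1 ≤ i → i ≤ j → j < n →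
    H.at i (j + 1) - H.at i j ≤ H.at (i - 1) j - H.at (i - 1) (j - 1)
  left : ∀ i j, 1 ≤ i → i ≤ j → j < n →
    H.at (i + 1) (j + 1) - H.at i (j + 1) ≤ H.at i j - H.at (i - 1) j

/-- The polytope `𝔥(lam, μ, ν)` of hives with prescribed partitions. -/
def hivePolytope (n : ℕ) (lam μ ν : YoungDiagram) : Set (Triangle n ℝ) :=
  {H | IsHive H ∧
    (∀ j, 1 ≤ j → j ≤ n → (part lam j : ℝ) = H.at j j - H.at (j - 1) (j - 1)) ∧
    (∀ j, 1 ≤ j → j ≤ n → (part μ j : ℝ) = H.at 0 j - H.at 0 (j - 1)) ∧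
    (∀ i, 1 ≤ i → i ≤ n → (part ν i : ℝ) = H.at i n - H.at (i - 1) n)}

/-- The integer points of a set of real triangles. -/
def integerPoints {n : ℕ} (P : Set (Triangle n ℝ)) : Set (Triangle n ℤ) :=
  {A | (fun p => (A p : ℝ)) ∈ P}

/-- The quadratic form `∑_{i,j} a_{i,j} ∑_{p < i} ∑_{p ≤ q < j} a_{p,q}` on triangles. -/
def Qtri {n : ℕ} {R : Type*} [CommRing R] (A : Triangle n R) : R :=
  ∑ i ∈ Finset.range (n + 1), ∑ j ∈ Finset.Icc i n,
    A.at i j * ∑ p ∈ Finset.range i, ∑ q ∈ Finset.Ico p j, A.at p q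

/-- The quadratic form `Q_𝔥` on hives. -/
def Qhive {n : ℕ} {R : Type*} [CommRing R] (H : Triangle n R) : R :=
  (∑ i ∈ Finset.Icc 1 n, ∑ j ∈ Finset.Icc i n,
    H.at (i - 1) (j - 1) *
      (H.at i j - H.at (i - 1) j - H.at i (j - 1) + H.at (i - 1) (j - 1)))
  - ∑ i ∈ Finset.Icc 1 (n - 1), H.at i i ^ 2

/-- The linear map `Φ`, `h_{i,j} = ∑_{p ≤ i} ∑_{p ≤ q ≤ j} a_{p,q}`. -/
def triangleToHive {n : ℕ} {R : Type*} [CommRing R] (A : Triangle n R) : Triangle n R :=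
  fun x => ∑ p ∈ Finset.range (x.1.1 + 1), ∑ q ∈ Finset.Icc p x.1.2, A.at p q

end OddLR

open OddLR

/-! The product formula is an odd version of the RSK correspondence. A tableau is peeled by removing
the horizontal strip of its largest letter (`schurSum`), and a sequence of weakly increasing words,
called runs, is peeled by removing the largest letter from the end of each run (`runSum`). Row
insertion of the runs into a tableau of shape `μ` makes the shape grow along a chain of horizontal
strips. `schurSum_mul_runSum` says that the product of the two sums is the signed sum, over the
Yamanouchi chains starting at `μ`, of the tableau sums of their final shapes.

This is proved by induction on the alphabet. The largest letter contributes a strip to the tableau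
and a multiplicity `m r` to each run; together with the chain `c'` of the smaller letters these data
determine the chain `c` through a row of local growth squares. Three properties of one square
suffice. The local rule is invertible (`grow_shrink`, `shrink_grow`). It turns the Yamanouchi
condition with defect `t r` into `m (r + 1) ≤ t r` together with the same condition for `c'` with
defect `t r - m (r + 1) + m r` (`yam_iff`), which is the recursion defining `runSum`. Finally, the
signs of insertion and of moving the largest letters to the end of a word cancel modulo 2
(`local_parity`).

With zero defects the runs are the rows, read from bottom to top, of a semistandard filling of the
diagram of `ν` turned by a half-turn. Inserting them into the empty tableau leaves only one chain,
the one that fills `ν` row by row, so their signed sum is the odd Schur polynomial of `ν`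
(`runSum_eq_oddSchurPoly`). Substituting this into the product formula expands `s_μ s_ν` over
chains. The coefficients are determined because the odd Schur functions are triangular for dominance
order with respect to ordered monomials (`linearIndependent_oddSchur`).

A zero-defect chain from `μ` to `lam` with strip sizes `ν` is the same as an integral
Littlewood–Richardson triangle, whose rows count the boxes of the strips. The sign exponent of the
chain splits into the quadratic form `Qtri` and a telescoping term in the counts `dN`
(`cast_chainExp`). Passing to hives takes partial sums, and the inverse takes integer differences.
-/

namespace OddLR

/-! ### Horizontal strips and the local growth rule -/

/-- The shape `α` is obtained from the shape `κ` by adding a horizontal strip. -/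
def Strip (κ α : ℕ → ℕ) : Prop := ∀ i, κ i ≤ α i ∧ α (i + 1) ≤ κ i

/-- The number of boxes passed to row `i` in the local growth rule. -/
def carry (κ α β : ℕ → ℕ) (m : ℕ) : ℕ → ℕ
  | 0 => m
  | i + 1 => min (α i) (β i) - κ i

/-- The forward local growth rule. -/
def grow (κ α β : ℕ → ℕ) (m : ℕ) (i : ℕ) : ℕ := max (α i) (β i) + carry κ α β m i

/-- The backward local growth rule. -/
def shrink (α β γ : ℕ → ℕ) (i : ℕ) : ℕ :=
  min (α i) (β i) - (γ (i + 1) - max (α (i + 1)) (β (i + 1)))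

/-- Row `i + 1` of the grown shape is `max (α (i + 1)) (β (i + 1)) + min (α i) (β i) - κ i`. Both `α
(i + 1)` and `β (i + 1)` are at most `κ i`, so this is at most `min (α i) (β i)`. -/
theorem Strip.grow_left {κ α β : ℕ → ℕ} (hα : Strip κ α) (hβ : Strip κ β) (m : ℕ) :
    Strip α (grow κ α β m) := by
  intro i
  have h1 := hα i
  have h2 := hβ i
  simp only [grow, carry]
  omega

theorem Strip.grow_right {κ α β : ℕ → ℕ} (hα : Strip κ α) (hβ : Strip κ β) (m : ℕ) :
    Strip β (grow κ α β m) := by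
  intro i
  have h1 := hα i
  have h2 := hβ i
  simp only [grow, carry]
  omega

theorem Strip.shrink_left {α β γ : ℕ → ℕ} (hα : Strip α γ) (hβ : Strip β γ) :
    Strip (shrink α β γ) α := by
  intro i
  have h1 := hα i
  have h2 := hβ i
  have h3 := hα (i + 1)
  have h4 := hβ (i + 1)
  simp only [shrink]
  omega

theorem Strip.shrink_right {α β γ : ℕ → ℕ} (hα : Strip α γ) (hβ : Strip β γ) :
    Strip (shrink α β γ) β := by
  intro i
  have h1 := hα i
  have h2 := hβ i
  have h3 := hα (i + 1)
  have h4 := hβ (i + 1)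
  simp only [shrink]
  omega

/-- The excess of `γ` over the maximum in row `i + 1` is the carry out of row `i`, which gives back
`κ i`. Row `0` receives no carry from above; its excess is the number of inserted boxes. -/
theorem grow_shrink {α β γ : ℕ → ℕ} (hα : Strip α γ) (hβ : Strip β γ) :
    grow (shrink α β γ) α β (γ 0 - max (α 0) (β 0)) = γ := by
  funext i
  cases i with
  | zero =>
    have h1 := hα 0
    have h2 := hβ 0
    simp only [grow, carry]
    omega
  | succ i =>
    have h1 := hα i
    have h2 := hβ i
    have h3 := hα (i + 1)
    have h4 := hβ (i + 1)
    simp only [grow, carry, shrink]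
    omega

theorem shrink_grow {κ α β : ℕ → ℕ} (hα : Strip κ α) (hβ : Strip κ β) (m : ℕ) :
    shrink α β (grow κ α β m) = κ := by
  funext i
  have h1 := hα i
  have h2 := hβ i
  simp only [grow, carry, shrink]
  omega

theorem grow_zero_sub (κ α β : ℕ → ℕ) (m : ℕ) :
    grow κ α β m 0 - max (α 0) (β 0) = m := by
  simp [grow, carry]

/-- Conservation of boxes in one row, from `max + min = sum`; the carries telescope when rows are
added up. -/
theorem grow_add_carry {κ α β : ℕ → ℕ} (hα : Strip κ α) (hβ : Strip κ β) (m i : ℕ) :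
    grow κ α β m i + carry κ α β m (i + 1) + κ i = α i + β i + carry κ α β m i := by
  have h1 := hα i
  have h2 := hβ i
  simp only [grow, carry]
  omega

/-! ### Sizes -/

/-- The number of boxes in the first `L` rows. -/
def size (L : ℕ) (κ : ℕ → ℕ) : ℕ := ∑ i ∈ Finset.range L, κ i

theorem size_mono {κ α : ℕ → ℕ} (h : ∀ i, κ i ≤ α i) (L : ℕ) : size L κ ≤ size L α :=
  Finset.sum_le_sum fun i _ => h i

theorem size_grow_add_carry {κ α β : ℕ → ℕ} (hα : Strip κ α) (hβ : Strip κ β) (m L : ℕ) :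
    size L (grow κ α β m) + carry κ α β m L + size L κ = size L α + size L β + m := by
  induction L with
  | zero => simp [size, carry]
  | succ L ih =>
    have := grow_add_carry hα hβ m L
    simp only [size, Finset.sum_range_succ] at ih ⊢
    omega

theorem carry_eq_zero {κ α β : ℕ → ℕ} {m L : ℕ} (h : grow κ α β m L = 0) :
    carry κ α β m L = 0 := by
  simp only [grow] at h
  omega

theorem size_grow {κ α β : ℕ → ℕ} (hα : Strip κ α) (hβ : Strip κ β) {m L : ℕ}
    (h : grow κ α β m L = 0) :
    size L (grow κ α β m) + size L κ = size L α + size L β + m := by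
  have := size_grow_add_carry hα hβ m L
  rw [carry_eq_zero h] at this
  omega

/-! ### The Yamanouchi condition -/

/-- The Yamanouchi condition with defect `t` for two successive strips `κ ⊆ κ' ⊆ κ''`. -/
def Yam (L : ℕ) (κ κ' κ'' : ℕ → ℤ) (t : ℤ) : Prop :=
  ∀ j ≤ L, ∑ q ∈ Finset.range (j + 1), (κ'' q - κ' q) ≤ t + ∑ q ∈ Finset.range j, (κ' q - κ q)

theorem yam_succ (L : ℕ) (κ κ' κ'' : ℕ → ℤ) (t : ℤ) :
    Yam (L + 1) κ κ' κ'' t ↔ κ'' 0 - κ' 0 ≤ t ∧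
      Yam L (fun i => κ (i + 1)) (fun i => κ' (i + 1)) (fun i => κ'' (i + 1))
        (t - (κ'' 0 - κ' 0) + (κ' 0 - κ 0)) := by
  constructor
  · intro h
    refine ⟨by simpa using h 0 (Nat.zero_le _), fun j hj => ?_⟩
    have := h (j + 1) (by omega)
    rw [Finset.sum_range_succ' (fun q => κ'' q - κ' q) (j + 1),
      Finset.sum_range_succ' (fun q => κ' q - κ q) j] at this
    simp only
    linarith
  · rintro ⟨h0, h⟩ j hj
    cases j with
    | zero => simpa using h0
    | succ j =>
      have := h j (by omega)
      rw [Finset.sum_range_succ' (fun q => κ'' q - κ' q) (j + 1),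
        Finset.sum_range_succ' (fun q => κ' q - κ q) j]
      simp only at this
      linarith

/-- Two adjacent growth squares, with carries `u` and `v`. Row `0` is split off on both sides; since
`max + min = sum`, the defects handed to the remaining rows agree, and only two inequalities on each
side, all in row `0`, remain to be compared. -/
theorem yam_iff (L : ℕ) : ∀ (κ κ' κ'' β β' β'' u v : ℕ → ℤ) (t : ℤ),
    (∀ i, β' i = max (κ' i) (β i) + u i) → (∀ i, u (i + 1) = min (κ' i) (β i) - κ i) →
    (∀ i, β'' i = max (κ'' i) (β' i) + v i) → (∀ i, v (i + 1) = min (κ'' i) (β' i) - κ' i) →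
    κ' L = 0 → κ'' L = 0 → β L = 0 → β' L = 0 → β'' L = 0 →
    (Yam L β β' β'' t ↔ v 0 ≤ t ∧ Yam L κ κ' κ'' (t - v 0 + u 0)) := by
  induction L with
  | zero =>
    intro κ κ' κ'' β β' β'' u v t h1 h2 h3 h4 z1 z2 z3 z4 z5
    have a1 := h1 0
    have a3 := h3 0
    simp only [Yam, Nat.le_zero, forall_eq, zero_add, Finset.sum_range_one, Finset.sum_range_zero]
    omega
  | succ L ih =>
    intro κ κ' κ'' β β' β'' u v t h1 h2 h3 h4 z1 z2 z3 z4 z5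
    rw [yam_succ, yam_succ, ih _ _ _ _ _ _ (fun i => u (i + 1)) (fun i => v (i + 1)) _
      (fun i => h1 (i + 1)) (fun i => h2 (i + 1)) (fun i => h3 (i + 1)) (fun i => h4 (i + 1))
      z1 z2 z3 z4 z5]
    have a1 := h1 0
    have a2 := h2 0
    have a3 := h3 0
    have a4 := h4 0
    simp only [zero_add]
    have e : t - (β'' 0 - β' 0) + (β' 0 - β 0) - v 1 + u 1 =
        t - v 0 + u 0 - (κ'' 0 - κ' 0) + (κ' 0 - κ 0) := by
      simp only [zero_add] at a2 a4
      omega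
    rw [e]
    simp only [zero_add] at a2 a4
    rw [← and_assoc, ← and_assoc]
    refine and_congr_left fun _ => ?_
    omega

/-! ### Signs -/

/-- The exponent of the sign of the insertion of a horizontal strip. -/
def insExp (L : ℕ) (κ α : ℕ → ℕ) : ℕ :=
  ∑ i ∈ Finset.range L, (α i - κ i) * ∑ p ∈ Finset.range i, (κ p + 1)

/-- The exponent of the sign that moves the boxes of a horizontal strip to the end
of the row word. -/
def wordExp (L : ℕ) (κ β : ℕ → ℕ) : ℕ :=
  ∑ i ∈ Finset.range L, (β i - κ i) * ∑ p ∈ Finset.range i, κ p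

/-- Over the first `L` rows the signs do not cancel: the carry still on its way to row `L` leaves
the right-hand side. With this correction the claim is inductive, and the correction vanishes once
the carry does. -/
theorem local_parity_aux (κ α β γ u : ℕ → ZMod 2) (h0 : ∀ i, γ i + u (i + 1) + κ i = α i + β i + u i)
    (h1 : ∀ i, (α i - κ i) * (β i - κ i) = u (i + 1) * (α i + β i + 1)) (L : ℕ) :
    ∑ i ∈ Finset.range L, (γ i - β i) * ∑ p ∈ Finset.range i, (β p + 1)
      + ∑ i ∈ Finset.range L, (α i - κ i) * ∑ p ∈ Finset.range i, (κ p + 1)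
      + ∑ i ∈ Finset.range L, (γ i - α i) * ∑ p ∈ Finset.range i, α p
      + ∑ i ∈ Finset.range L, (β i - κ i) * ∑ p ∈ Finset.range i, κ p
      + (∑ i ∈ Finset.range L, β i - ∑ i ∈ Finset.range L, κ i) *
        (∑ i ∈ Finset.range L, α i - ∑ i ∈ Finset.range L, κ i)
      = u L * (∑ i ∈ Finset.range L, α i + ∑ i ∈ Finset.range L, β i + L) := by
  have h2 : (2 : ZMod 2) = 0 := rfl
  induction L with
  | zero => simp
  | succ L ih =>
    simp only [Finset.sum_range_succ, Finset.sum_add_distrib, Finset.sum_const, Finset.card_range,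
      nsmul_eq_mul, mul_one] at ih ⊢
    push_cast
    generalize ∑ i ∈ Finset.range L, α i = A at *
    generalize ∑ i ∈ Finset.range L, β i = B at *
    generalize ∑ i ∈ Finset.range L, κ i = K at *
    generalize (L : ZMod 2) = l at *
    generalize ∑ x ∈ Finset.range L, (γ x - β x) * (∑ p ∈ Finset.range x, β p + x) = s1 at *
    generalize ∑ x ∈ Finset.range L, (α x - κ x) * (∑ p ∈ Finset.range x, κ p + x) = s2 at *
    generalize ∑ x ∈ Finset.range L, (γ x - α x) * (∑ p ∈ Finset.range x, α p) = s3 at *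
    generalize ∑ x ∈ Finset.range L, (β x - κ x) * (∑ p ∈ Finset.range x, κ p) = s4 at *
    have h0 := h0 L
    have h1 := h1 L
    generalize α L = a at *
    generalize β L = b at *
    generalize γ L = c at *
    generalize κ L = k at *
    generalize u L = m at *
    generalize u (L + 1) = m' at *
    have hc : c = a + b + m - m' - k := by linear_combination h0
    have hs : s4 = m * (A + B + l) - (s1 + s2 + s3 + (B - K) * (A - K)) := by linear_combination ih
    subst hs hc
    revert h1
    clear h0 ih
    intro h1
    have key : ∀ a b k m m' A B K l : ZMod 2, (a - k) * (b - k) = m' * (a + b + 1) →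
      (a + b + m - m' - k - b) * (B + l) + (a - k) * (K + l) + (a + b + m - m' - k - a) * A +
        (b - k) * K + m * (A + B + l) - (B - K) * (A - K) + (B + b - (K + k)) * (A + a - (K + k))
       - m' * (A + a + (B + b) + (l + 1)) = 0 := by
      intro a b k m m' A B K l h
      linear_combination (-1) * h + (a * b - a * m' - a * k + a * B + a * l - b * m' - b * k + b * A
        + m * B + m * l + m * A - m' - m' * B - m' * l - m' * A - k * B - k * l - k * A
        + k ^ 2) * h2
    linear_combination key a b k m m' A B K l h1

theorem zmod_two_eq_zero_or_one : ∀ x : ZMod 2, x = 0 ∨ x = 1 := by decide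

theorem Strip.sub_cast {κ α : ℕ → ℕ} (h : Strip κ α) (i : ℕ) :
    ((α i - κ i : ℕ) : ZMod 2) = (α i : ZMod 2) - κ i := Nat.cast_sub (h i).1

/-- The first four exponents belong to the sides of a growth square. The product of sizes is the
cost of moving the largest letters of the tableau, in `β / κ`, past the smaller letters of the run,
which add `α / κ`. -/
theorem local_parity {κ α β : ℕ → ℕ} (hα : Strip κ α) (hβ : Strip κ β) {m L : ℕ}
    (h : grow κ α β m L = 0) :
    ((insExp L β (grow κ α β m) + insExp L κ α + wordExp L α (grow κ α β m) + wordExp L κ β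
      + (size L β - size L κ) * (size L α - size L κ) : ℕ) : ZMod 2) = 0 := by
  have key := local_parity_aux (fun i => κ i) (fun i => α i) (fun i => β i)
    (fun i => grow κ α β m i) (fun i => carry κ α β m i) (fun i => ?_) (fun i => ?_) L
  · rw [carry_eq_zero h] at key
    simp only [Nat.cast_zero, zero_mul] at key
    rw [← key]
    simp only [insExp, wordExp, size, Nat.cast_add, Nat.cast_sum, Nat.cast_mul, hα.sub_cast,
      hβ.sub_cast, (hα.grow_left hβ m).sub_cast, (hα.grow_right hβ m).sub_cast, Nat.cast_one]
    congr 1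
    rw [Nat.cast_sub (Finset.sum_le_sum fun i _ => (hα i).1),
      Nat.cast_sub (Finset.sum_le_sum fun i _ => (hβ i).1)]
    push_cast
    rfl
  · exact_mod_cast congrArg (Nat.cast : ℕ → ZMod 2) (grow_add_carry hα hβ m i)
  · have h1 := (hα i).1
    have h2 := (hβ i).1
    simp only [carry]
    rw [← Nat.cast_sub h1, ← Nat.cast_sub h2]
    obtain ⟨a, ha⟩ := Nat.exists_eq_add_of_le h1
    obtain ⟨b, hb⟩ := Nat.exists_eq_add_of_le h2
    have t2 : (2 : ZMod 2) = 0 := rfl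
    rw [ha, hb]
    simp only [Nat.add_sub_cancel_left, Nat.add_min_add_left, Nat.cast_add]
    -- If `a ≤ b`, the claim is `a * b = a * (a + b + 1)` modulo 2, that is, `a ^ 2 + a = 0`; the
    -- other case is symmetric.
    rcases le_total a b with hab | hab
    · rw [min_eq_left hab]
      rcases zmod_two_eq_zero_or_one (a : ZMod 2) with e | e <;> rw [e]
      · ring
      · linear_combination (-(κ i : ZMod 2) - 1) * t2
    · rw [min_eq_right hab]
      rcases zmod_two_eq_zero_or_one (b : ZMod 2) with e | e <;> rw [e]
      · ring
      · linear_combination (-(κ i : ZMod 2) - 1) * t2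

/-! ### Finite sets of functions -/

/-- Shapes and chains are functions on `ℕ`; stabilizing at `n` leaves only `n + 1` free values, so
that sums over them are finite. -/
theorem finite_eventuallyConst {α : Type*} (n : ℕ) (X : ℕ → Finset α) :
    {f : ℕ → α | (∀ i, f i ∈ X i) ∧ ∀ i, n ≤ i → f i = f n}.Finite := by
  refine ((Fintype.piFinset fun i : Fin (n + 1) => X i).finite_toSet.image
    fun (g : Fin (n + 1) → α) (i : ℕ) => g ⟨min i n, by omega⟩).subset ?_
  rintro f ⟨h1, h2⟩
  refine ⟨fun i => f i, by simpa using fun i => h1 _, ?_⟩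
  funext i
  rcases le_total i n with h | h
  · simp [h]
  · simp [h, h2 i h]

theorem finite_box (L : ℕ) (B : ℕ → ℕ) :
    {f : ℕ → ℕ | (∀ i, f i ≤ B i) ∧ ∀ i, L ≤ i → f i = 0}.Finite := by
  refine (finite_eventuallyConst L fun i => Finset.range (B i + 1)).subset ?_
  rintro f ⟨h1, h2⟩
  exact ⟨fun i => by simpa [Nat.lt_succ_iff] using h1 i,
    fun i hi => by rw [h2 i hi, h2 L le_rfl]⟩

/-- The functions bounded by `B` and supported on `{0, …, L - 1}`. -/
noncomputable def box (L : ℕ) (B : ℕ → ℕ) : Finset (ℕ → ℕ) := (finite_box L B).toFinset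

@[simp] theorem mem_box {L : ℕ} {B f : ℕ → ℕ} :
    f ∈ box L B ↔ (∀ i, f i ≤ B i) ∧ ∀ i, L ≤ i → f i = 0 := by
  simp [box]

open Classical in
/-- The shapes obtained from `κ` by removing a horizontal strip. -/
noncomputable def below (L : ℕ) (κ : ℕ → ℕ) : Finset (ℕ → ℕ) := {f ∈ box L κ | Strip f κ}

theorem mem_below {L : ℕ} {κ f : ℕ → ℕ} (hκ : ∀ i, L ≤ i → κ i = 0) :
    f ∈ below L κ ↔ Strip f κ := by
  simp only [below, Finset.mem_filter, mem_box, and_iff_right_iff_imp]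
  exact fun h => ⟨fun i => (h i).1, fun i hi => Nat.le_zero.1 (hκ i hi ▸ (h i).1)⟩

/-! ### Chains of horizontal strips -/

/-- Chains of horizontal strips of sizes `ρ 0, ρ 1, …`, starting with `μ`, that satisfy
the Yamanouchi conditions with defects `t`. -/
structure IsChain (L : ℕ) (μ ρ t : ℕ → ℕ) (c : ℕ → ℕ → ℕ) : Prop where
  start : c 0 = μ
  strip : ∀ r, Strip (c r) (c (r + 1))
  zero : ∀ r i, L ≤ i → c r i = 0
  size_eq : ∀ r, size L (c (r + 1)) = size L (c r) + ρ r
  yam : ∀ r, Yam L (fun i => c r i) (fun i => c (r + 1) i) (fun i => c (r + 2) i) (t r)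

theorem eq_of_size_eq {L : ℕ} {κ α : ℕ → ℕ} (h : ∀ i, κ i ≤ α i)
    (hα : ∀ i, L ≤ i → α i = 0) (hs : size L κ = size L α) : κ = α := by
  funext i
  rcases lt_or_ge i L with hi | hi
  · exact (Finset.sum_eq_sum_iff_of_le fun i _ => h i).1 hs i (Finset.mem_range.2 hi)
  · exact (Nat.le_zero.1 (hα i hi ▸ h i)).trans (hα i hi).symm

theorem IsChain.eq_of_le {L n : ℕ} {μ ρ t : ℕ → ℕ} {c : ℕ → ℕ → ℕ} (h : IsChain L μ ρ t c)
    (hρ : ∀ r, n ≤ r → ρ r = 0) (r : ℕ) (hr : n ≤ r) : c r = c n := by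
  induction r, hr using Nat.le_induction with
  | base => rfl
  | succ r hr ih =>
    rw [← ih]
    exact (eq_of_size_eq (fun i => (h.strip r i).1) (h.zero (r + 1))
      (by rw [h.size_eq, hρ r hr, add_zero])).symm

theorem IsChain.size_le {L n : ℕ} {μ ρ t : ℕ → ℕ} {c : ℕ → ℕ → ℕ} (h : IsChain L μ ρ t c)
    (hρ : ∀ r, n ≤ r → ρ r = 0) (r : ℕ) : size L (c r) ≤ size L μ + size n ρ := by
  have key : ∀ r, size L (c r) = size L μ + size r ρ := by
    intro r
    induction r with
    | zero => simp [h.start, size]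
    | succ r ih => rw [h.size_eq, ih, add_assoc, size, size, size, Finset.sum_range_succ]
  rcases le_total r n with hr | hr
  · rw [key]
    exact Nat.add_le_add_left (Finset.sum_le_sum_of_subset (by simpa using hr)) _
  · rw [h.eq_of_le hρ r hr, key]

open Classical in
/-- The finite set of chains, see `IsChain`. -/
noncomputable def chains (L n : ℕ) (μ ρ t : ℕ → ℕ) : Finset (ℕ → ℕ → ℕ) :=
  {c ∈ (finite_eventuallyConst n fun _ => box L fun _ => size L μ + size n ρ).toFinset |
    IsChain L μ ρ t c}

theorem mem_chains {L n : ℕ} {μ ρ t : ℕ → ℕ} (hρ : ∀ r, n ≤ r → ρ r = 0) {c : ℕ → ℕ → ℕ} :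
    c ∈ chains L n μ ρ t ↔ IsChain L μ ρ t c := by
  simp only [chains, Finset.mem_filter, Set.Finite.mem_toFinset, Set.mem_ofPred_eq, mem_box,
    and_iff_right_iff_imp]
  refine fun h => ⟨fun r => ⟨fun i => ?_, h.zero r⟩, h.eq_of_le hρ⟩
  rcases lt_or_ge i L with hi | hi
  · exact (Finset.single_le_sum (f := c r) (fun _ _ => Nat.zero_le _) (Finset.mem_range.2 hi)).trans
      (h.size_le hρ r)
  · rw [h.zero r i hi]
    exact Nat.zero_le _

/-! ### Growth of chains -/

/-- The chain grown from the chain `c` by a strip with target `μ` and insertions `m`. -/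
def ascend (c : ℕ → ℕ → ℕ) (μ m : ℕ → ℕ) : ℕ → ℕ → ℕ
  | 0 => μ
  | r + 1 => grow (c r) (c (r + 1)) (ascend c μ m r) (m r)

/-- The shapes of `descend`, numbered backwards. -/
def descendAux (c : ℕ → ℕ → ℕ) (f : ℕ → ℕ) (n : ℕ) : ℕ → ℕ → ℕ
  | 0 => f
  | j + 1 => shrink (descendAux c f n j) (c (n - 1 - j)) (c (n - j))

/-- The inverse of `ascend`, for chains of length `n`. -/
def descend (c : ℕ → ℕ → ℕ) (f : ℕ → ℕ) (n r : ℕ) : ℕ → ℕ := descendAux c f n (n - r)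

theorem descend_of_le (c : ℕ → ℕ → ℕ) (f : ℕ → ℕ) {n r : ℕ} (h : n ≤ r) :
    descend c f n r = f := by
  rw [descend, Nat.sub_eq_zero_of_le h, descendAux]

theorem descend_of_lt (c : ℕ → ℕ → ℕ) (f : ℕ → ℕ) {n r : ℕ} (h : r < n) :
    descend c f n r = shrink (descend c f n (r + 1)) (c r) (c (r + 1)) := by
  obtain ⟨j, rfl⟩ := Nat.exists_eq_add_of_lt h
  rw [descend, descend, show r + j + 1 - r = j + 1 by omega, show r + j + 1 - (r + 1) = j by omega,
    descendAux]
  congr 1 <;> congr 1 <;> omega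

/-- The chain `c` is grown from the chain `c'` with insertions `m`. -/
structure GrowthPair (L : ℕ) (c' : ℕ → ℕ → ℕ) (m : ℕ → ℕ) (c : ℕ → ℕ → ℕ) : Prop where
  strip_left : ∀ r, Strip (c' r) (c' (r + 1))
  strip : ∀ r, Strip (c' r) (c r)
  zero : ∀ r i, L ≤ i → c r i = 0
  grow_eq : ∀ r, c (r + 1) = grow (c' r) (c' (r + 1)) (c r) (m r)

namespace GrowthPair

variable {L : ℕ} {c' c : ℕ → ℕ → ℕ} {m : ℕ → ℕ}

theorem strip_right (h : GrowthPair L c' m c) (r : ℕ) : Strip (c r) (c (r + 1)) := by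
  rw [h.grow_eq]
  exact (h.strip_left r).grow_right (h.strip r) _

theorem zero_left (h : GrowthPair L c' m c) (r i : ℕ) (hi : L ≤ i) : c' r i = 0 :=
  Nat.le_zero.1 (h.zero r i hi ▸ (h.strip r i).1)

theorem size_eq (h : GrowthPair L c' m c) (r : ℕ) :
    size L (c (r + 1)) + size L (c' r) = size L (c' (r + 1)) + size L (c r) + m r := by
  have h0 := h.zero (r + 1) L le_rfl
  rw [h.grow_eq] at h0 ⊢
  exact size_grow (h.strip_left r) (h.strip r) h0

theorem carry_succ (h : GrowthPair L c' m c) (r i : ℕ) :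
    ((carry (c' r) (c' (r + 1)) (c r) (m r) (i + 1) : ℕ) : ℤ) =
      min (c' (r + 1) i : ℤ) (c r i) - c' r i := by
  have h1 := h.strip_left r i
  have h2 := h.strip r i
  simp only [carry]
  omega

theorem apply_succ (h : GrowthPair L c' m c) (r i : ℕ) :
    (c (r + 1) i : ℤ) = max (c' (r + 1) i : ℤ) (c r i) +
      (carry (c' r) (c' (r + 1)) (c r) (m r) i : ℕ) := by
  rw [h.grow_eq, grow]
  push_cast
  rfl

/-- The incoming carries in row `0` are the insertions `m r` and `m (r + 1)`, so the defect changes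
exactly as in the recursion for `runSum`. -/
theorem yam_iff (h : GrowthPair L c' m c) (r t : ℕ) :
    Yam L (fun i => c r i) (fun i => c (r + 1) i) (fun i => c (r + 2) i) t ↔
      m (r + 1) ≤ t ∧ Yam L (fun i => c' r i) (fun i => c' (r + 1) i) (fun i => c' (r + 2) i)
        (t - m (r + 1) + m r : ℤ) := by
  rw [OddLR.yam_iff L (fun i => c' r i) (fun i => c' (r + 1) i) (fun i => c' (r + 2) i)
    (fun i => c r i) (fun i => c (r + 1) i) (fun i => c (r + 2) i)
    (fun i => (carry (c' r) (c' (r + 1)) (c r) (m r) i : ℕ))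
    (fun i => (carry (c' (r + 1)) (c' (r + 2)) (c (r + 1)) (m (r + 1)) i : ℕ)) t
    (h.apply_succ r) (h.carry_succ r) (h.apply_succ (r + 1)) (h.carry_succ (r + 1))
    (by simp [h.zero_left]) (by simp [h.zero_left])
    (by simp [h.zero]) (by simp [h.zero]) (by simp [h.zero])]
  simp [carry]

theorem isChain_iff (h : GrowthPair L c' m c) (ρ t : ℕ → ℕ) :
    IsChain L (c 0) ρ t c ↔ (∀ r, m r ≤ ρ r) ∧ (∀ r, m (r + 1) ≤ t r) ∧
      IsChain L (c' 0) (fun r => ρ r - m r) (fun r => t r - m (r + 1) + m r) c' := by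
  have cast : ∀ r, m (r + 1) ≤ t r →
      ((t r - m (r + 1) + m r : ℕ) : ℤ) = (t r - m (r + 1) + m r : ℤ) := fun r hr => by omega
  constructor
  · intro hc
    have hm : ∀ r, m (r + 1) ≤ t r := fun r => ((h.yam_iff r (t r)).1 (hc.yam r)).1
    refine ⟨fun r => ?_, hm, rfl, h.strip_left, h.zero_left, fun r => ?_, fun r => ?_⟩
    · have h1 := h.size_eq r
      have h2 := hc.size_eq r
      have h3 := size_mono (fun i => (h.strip_left r i).1) L
      omega
    · have h1 := h.size_eq r
      have h2 := hc.size_eq r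
      have h3 := size_mono (fun i => (h.strip_left r i).1) L
      omega
    · rw [cast r (hm r)]
      exact ((h.yam_iff r (t r)).1 (hc.yam r)).2
  · rintro ⟨h1, h2, hc⟩
    refine ⟨rfl, h.strip_right, h.zero, fun r => ?_, fun r => ?_⟩
    · have h3 := h.size_eq r
      have h4 := hc.size_eq r
      have h5 := h1 r
      omega
    · refine (h.yam_iff r (t r)).2 ⟨h2 r, ?_⟩
      rw [← cast r (h2 r)]
      exact hc.yam r

end GrowthPair

theorem strip_ascend {c' : ℕ → ℕ → ℕ} (hs : ∀ r, Strip (c' r) (c' (r + 1))) {μ : ℕ → ℕ}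
    (hμ : Strip (c' 0) μ) (m : ℕ → ℕ) (r : ℕ) : Strip (c' r) (ascend c' μ m r) := by
  induction r with
  | zero => exact hμ
  | succ r ih => exact (hs r).grow_left ih _

/-- Squares beyond the last run are trivial, so a grown chain also becomes stationary. -/
theorem grow_self_zero {κ β : ℕ → ℕ} (h : Strip κ β) : grow κ κ β 0 = β := by
  funext i
  cases i with
  | zero =>
    have := h 0
    simp only [grow, carry]
    omega
  | succ i =>
    have h1 := h i
    have h2 := h (i + 1)
    simp only [grow, carry]
    omega

/-- A horizontal strip adds at most one new row, and only the first `n` squares can be nontrivial;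
hence `L₀ + n` rows are enough throughout. -/
theorem growthPair_ascend {L L₀ n : ℕ} (hL : L₀ + n ≤ L) {c' : ℕ → ℕ → ℕ}
    (hs : ∀ r, Strip (c' r) (c' (r + 1))) (hc : ∀ r, n ≤ r → c' (r + 1) = c' r) {μ m : ℕ → ℕ}
    (hμ : Strip (c' 0) μ) (hμ0 : ∀ i, L₀ ≤ i → μ i = 0) (hm : ∀ r, n ≤ r → m r = 0) :
    GrowthPair L c' m (ascend c' μ m) := by
  have hst := strip_ascend hs hμ m
  have hst' : ∀ r, Strip (ascend c' μ m r) (ascend c' μ m (r + 1)) := fun r =>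
    (hs r).grow_right (hst r) _
  refine ⟨hs, hst, fun r i hi => ?_, fun r => rfl⟩
  have h1 : ∀ r i, L₀ + r ≤ i → ascend c' μ m r i = 0 := by
    intro r
    induction r with
    | zero => exact hμ0
    | succ r ih =>
      intro i hi
      obtain ⟨i, rfl⟩ : ∃ j, i = j + 1 := ⟨i - 1, by omega⟩
      have := (hst' r i).2
      rw [ih i (by omega)] at this
      exact Nat.le_zero.1 this
  rcases le_total r n with hr | hr
  · exact h1 r i (by omega)
  · have h2 : ascend c' μ m r = ascend c' μ m n := by
      induction r, hr using Nat.le_induction with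
      | base => rfl
      | succ r hr ih =>
        rw [ascend, hc r hr, hm r hr, grow_self_zero (hst r), ih]
    rw [h2]
    exact h1 n i (by omega)

theorem strip_descend {c : ℕ → ℕ → ℕ} {n : ℕ} (hs : ∀ r, Strip (c r) (c (r + 1)))
    (hc : ∀ r, n ≤ r → c r = c n) {f : ℕ → ℕ} (hf : Strip f (c n)) (r : ℕ) :
    Strip (descend c f n r) (c r) := by
  rcases le_total n r with h | h
  · rw [descend_of_le c f h, hc r h]
    exact hf
  · induction h using Nat.decreasingInduction with
    | self => rwa [descend_of_le c f le_rfl]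
    | of_succ r hr ih =>
      rw [descend_of_lt c f hr]
      exact ih.shrink_right (hs r)

/-- The squares are rebuilt backwards from the inner shape `f` of the last shape, and the insertions
are read off from the excess in row `0`. -/
theorem growthPair_descend {L n : ℕ} {c : ℕ → ℕ → ℕ} (hs : ∀ r, Strip (c r) (c (r + 1)))
    (hz : ∀ r i, L ≤ i → c r i = 0)
    (hc : ∀ r, n ≤ r → c r = c n) {f : ℕ → ℕ} (hf : Strip f (c n)) :
    GrowthPair L (descend c f n)
      (fun r => c (r + 1) 0 - max (descend c f n (r + 1) 0) (c r 0)) c := by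
  have hst := strip_descend hs hc hf
  refine ⟨fun r => ?_, hst, hz, fun r => ?_⟩
  · rcases lt_or_ge r n with h | h
    · rw [descend_of_lt c f h]
      exact (hst (r + 1)).shrink_left (hs r)
    · rw [descend_of_le c f h, descend_of_le c f (h.trans (Nat.le_succ r))]
      exact fun i => ⟨le_rfl, (hf (i + 1)).1.trans (hf i).2⟩
  · rcases lt_or_ge r n with h | h
    · rw [descend_of_lt c f h]
      exact (grow_shrink (hst (r + 1)) (hs r)).symm
    · rw [descend_of_le c f h, descend_of_le c f (h.trans (Nat.le_succ r)), hc r h,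
        hc (r + 1) (h.trans (Nat.le_succ r))]
      rw [max_eq_right (hf 0).1, Nat.sub_self, grow_self_zero hf]

/-! ### Signs of chains -/

/-- The exponent of the sign of a chain of insertions. -/
def chainExp (L n : ℕ) (c : ℕ → ℕ → ℕ) : ℕ := ∑ r ∈ Finset.range n, insExp L (c r) (c (r + 1))

/-- The exponent of the sign that moves the last letters of the runs to the end. -/
def runExp (n : ℕ) (m ρ : ℕ → ℕ) : ℕ := ∑ r ∈ Finset.range n, size r m * ρ r

theorem GrowthPair.size_sub {L : ℕ} {c' c : ℕ → ℕ → ℕ} {m : ℕ → ℕ} (h : GrowthPair L c' m c)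
    (n : ℕ) : size L (c n) - size L (c' n) = size L (c 0) - size L (c' 0) + size n m := by
  induction n with
  | zero => simp [size]
  | succ n ih =>
    have h1 := h.size_eq n
    have h2 := size_mono (fun i => (h.strip n i).1) L
    have h3 : size (n + 1) m = size n m + m n := by simp [size, Finset.sum_range_succ]
    omega

/-- The signs of `n` adjacent squares are added. The `wordExp` of each interior side occurs twice,
so only the two outer ones survive; by `GrowthPair.size_sub` the products of sizes split into
`runExp` and the contribution of the initial strip. -/
theorem GrowthPair.parity {L : ℕ} {c' c : ℕ → ℕ → ℕ} {m : ℕ → ℕ} (h : GrowthPair L c' m c)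
    {ρ : ℕ → ℕ} (hρ : ∀ r, size L (c' (r + 1)) = size L (c' r) + ρ r) (n : ℕ) :
    ((chainExp L n c + chainExp L n c' + wordExp L (c' n) (c n) + wordExp L (c' 0) (c 0)
      + runExp n m ρ + (size L (c 0) - size L (c' 0)) * size n ρ : ℕ) : ZMod 2) = 0 := by
  have h2 : (2 : ZMod 2) = 0 := rfl
  induction n with
  | zero =>
    simp only [chainExp, runExp, size, Finset.range_zero, Finset.sum_empty]
    push_cast
    linear_combination (wordExp L (c' 0) (c 0) : ZMod 2) * h2
  | succ n ih =>
    have h0 := h.zero (n + 1) L le_rfl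
    rw [h.grow_eq] at h0
    have key := local_parity (h.strip_left n) (h.strip n) h0
    rw [← h.grow_eq, h.size_sub n, hρ n, Nat.add_sub_cancel_left] at key
    have e1 : chainExp L (n + 1) c = chainExp L n c + insExp L (c n) (c (n + 1)) :=
      Finset.sum_range_succ _ _
    have e2 : chainExp L (n + 1) c' = chainExp L n c' + insExp L (c' n) (c' (n + 1)) :=
      Finset.sum_range_succ _ _
    have e3 : runExp (n + 1) m ρ = runExp n m ρ + size n m * ρ n := Finset.sum_range_succ _ _
    have e4 : size (n + 1) ρ = size n ρ + ρ n := Finset.sum_range_succ _ _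
    rw [e1, e2, e3, e4]
    push_cast at ih key ⊢
    linear_combination ih + key - (wordExp L (c' n) (c n) : ZMod 2) * h2

theorem GrowthPair.descend_eq {L n : ℕ} {c' c : ℕ → ℕ → ℕ} {m : ℕ → ℕ} (h : GrowthPair L c' m c)
    (hc : ∀ r, n ≤ r → c' r = c' n) : descend c (c' n) n = c' := by
  funext r
  rcases le_total n r with hr | hr
  · rw [descend_of_le c _ hr, hc r hr]
  · induction hr using Nat.decreasingInduction with
    | self => exact descend_of_le c _ le_rfl
    | of_succ r hr ih =>
      rw [descend_of_lt c _ hr, ih, h.grow_eq, shrink_grow (h.strip_left r) (h.strip r)]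

theorem GrowthPair.ascend_eq {L : ℕ} {c' c : ℕ → ℕ → ℕ} {m : ℕ → ℕ} (h : GrowthPair L c' m c) :
    ascend c' (c 0) m = c := by
  funext r
  induction r with
  | zero => rfl
  | succ r ih => rw [ascend, ih, h.grow_eq]

theorem negOne_pow_congr {a b : ℕ} (h : (a : ZMod 2) = b) : (-1 : ℤ) ^ a = (-1) ^ b := by
  have h1 := (ZMod.natCast_eq_natCast_iff a b 2).1 h
  refine neg_one_pow_congr ?_
  rw [Nat.even_iff, Nat.even_iff, h1]

/-! ### The product formula in a ring with anticommuting elements -/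

section Ring

variable {R : Type*} [Ring R] (y : ℕ → R)

open Classical in
/-- The signed sum over the tableaux of shape `κ` with entries in `{0, …, k - 1}`, by recursion
on `k`. -/
noncomputable def schurSum (L : ℕ) : ℕ → (ℕ → ℕ) → R
  | 0, κ => if κ = 0 then 1 else 0
  | k + 1, κ => ∑ f ∈ below L κ,
      (-1 : ℤ) ^ wordExp L f κ • (schurSum L k f * y k ^ (size L κ - size L f))

open Classical in
/-- The signed sum over the sequences of weakly increasing runs of lengths `ρ 0, ρ 1, …` with
entries in `{0, …, k - 1}` that satisfy Yamanouchi conditions with defects `t`, by recursion on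
`k`. -/
noncomputable def runSum (n : ℕ) : ℕ → (ℕ → ℕ) → (ℕ → ℕ) → R
  | 0, ρ, _ => if ρ = 0 then 1 else 0
  | k + 1, ρ, t => ∑ m ∈ box n ρ with ∀ r, m (r + 1) ≤ t r,
      (-1 : ℤ) ^ runExp n m (fun r => ρ r - m r) •
        (runSum n k (fun r => ρ r - m r) (fun r => t r - m (r + 1) + m r) * y k ^ size n m)

variable {y}

theorem mul_pow_anticomm {a b : R} (e : ℕ) (h : a * b = (-1 : ℤ) ^ e • (b * a)) (d : ℕ) :
    a ^ d * b = (-1 : ℤ) ^ (d * e) • (b * a ^ d) := by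
  induction d with
  | zero => simp
  | succ d ih =>
    rw [pow_succ, mul_assoc, h, mul_smul_comm, ← mul_assoc, ih, smul_mul_assoc, smul_smul,
      ← pow_add, mul_assoc]
    congr 2
    ring

theorem pow_anticomm (hy : ∀ i j, i ≠ j → y i * y j = -(y j * y i)) {i j : ℕ} (h : i ≠ j) (d : ℕ) :
    y i * y j ^ d = (-1 : ℤ) ^ d • (y j ^ d * y i) := by
  have h1 := mul_pow_anticomm (a := y j) (b := y i) 1 (by simp [hy j i h.symm]) d
  rw [h1, smul_smul, mul_one, ← pow_add, ← two_mul, pow_mul]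
  simp

theorem size_sub_add {n : ℕ} {m ρ : ℕ → ℕ} (h : ∀ r, m r ≤ ρ r) :
    size n (fun r => ρ r - m r) + size n m = size n ρ := by
  rw [size, size, size, ← Finset.sum_add_distrib]
  exact Finset.sum_congr rfl fun r _ => Nat.sub_add_cancel (h r)

/-- Each term is a product of `size n ρ` letters, all of index below `k ≤ j`, and each of them costs
one sign. -/
theorem mul_runSum (hy : ∀ i j, i ≠ j → y i * y j = -(y j * y i)) (n : ℕ) {j k : ℕ} (h : k ≤ j)
    (ρ t : ℕ → ℕ) :
    y j * runSum y n k ρ t = (-1 : ℤ) ^ size n ρ • (runSum y n k ρ t * y j) := by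
  induction k generalizing ρ t with
  | zero =>
    simp only [runSum]
    split_ifs with h0
    · simp [h0, size]
    · simp
  | succ k ih =>
    simp only [runSum]
    rw [Finset.mul_sum, Finset.sum_mul, Finset.smul_sum]
    refine Finset.sum_congr rfl fun m hm => ?_
    simp only [Finset.mem_filter, mem_box] at hm
    rw [mul_smul_comm, ← mul_assoc, ih (by omega), smul_mul_assoc, smul_mul_assoc, mul_assoc,
      pow_anticomm hy (by omega : j ≠ k), mul_smul_comm, smul_smul, smul_smul, smul_smul,
      mul_assoc, mul_comm (_ ^ runExp _ _ _), ← pow_add, size_sub_add hm.1.1, mul_assoc]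

theorem chains_zero (L n : ℕ) (t : ℕ → ℕ) : chains L n 0 0 t = {0} := by
  ext c
  rw [mem_chains (ρ := 0) (fun _ _ => rfl), Finset.mem_singleton]
  constructor
  · intro h
    funext r i
    rcases lt_or_ge i L with hi | hi
    · have h1 := h.size_le (n := 0) (fun _ _ => rfl) r
      have h2 := Finset.single_le_sum (f := c r) (fun _ _ => Nat.zero_le _) (Finset.mem_range.2 hi)
      simp only [size, Pi.zero_apply, Finset.sum_const_zero] at h1
      simp only [Pi.zero_apply]
      omega
    · exact h.zero r i hi
  · rintro rfl
    exact ⟨rfl, fun r i => by simp, fun _ _ _ => rfl, fun _ => by simp, fun r j _ => by simp⟩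

theorem IsChain.mono {L : ℕ} {μ ρ t : ℕ → ℕ} {c : ℕ → ℕ → ℕ} (h : IsChain L μ ρ t c) {r s : ℕ}
    (hrs : r ≤ s) (i : ℕ) : c r i ≤ c s i := by
  induction s, hrs using Nat.le_induction with
  | base => exact le_rfl
  | succ s _ ih => exact ih.trans (h.strip s i).1

theorem IsChain.eq_zero {L n : ℕ} {μ ρ t : ℕ → ℕ} (hρ : ∀ r, n ≤ r → ρ r = 0) {c : ℕ → ℕ → ℕ}
    (h : IsChain L μ ρ t c) (hc : c n = 0) : μ = 0 ∧ ρ = 0 := by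
  have h0 : ∀ r, c r = 0 := by
    intro r
    rcases le_total r n with hr | hr
    · funext i
      have := h.mono hr i
      rw [hc] at this
      exact Nat.le_zero.1 this
    · rw [h.eq_of_le hρ r hr, hc]
  refine ⟨by rw [← h.start, h0], funext fun r => ?_⟩
  have := h.size_eq r
  rw [h0, h0] at this
  simpa using this

/-- After peeling off the letter `k` and using the induction hypothesis, the left side runs over an
inner shape of `μ`, insertions and a chain from that inner shape; the right side runs over a chain
from `μ` and an inner shape of its end. A row of growth squares matches the two. -/
theorem schurSum_mul_runSum (hy : ∀ i j, i ≠ j → y i * y j = -(y j * y i)) {L L₀ n : ℕ}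
    (hL : L₀ + n ≤ L) (k : ℕ) (μ ρ t : ℕ → ℕ) (hμ : ∀ i, L₀ ≤ i → μ i = 0)
    (hρ : ∀ r, n ≤ r → ρ r = 0) :
    schurSum y L k μ * runSum y n k ρ t =
      ∑ c ∈ chains L n μ ρ t, (-1 : ℤ) ^ chainExp L n c • schurSum y L k (c n) := by
  classical
  induction k generalizing μ ρ t with
  | zero =>
    simp only [schurSum, runSum]
    -- With no letters, only the empty tableau and empty runs occur; likewise a chain ending in the
    -- empty shape is empty from the start.
    by_cases h : μ = 0 ∧ ρ = 0
    · obtain ⟨rfl, rfl⟩ := h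
      rw [chains_zero]
      simp [chainExp, insExp]
    · rw [Finset.sum_eq_zero]
      · rw [not_and_or] at h
        rcases h with h | h <;> simp [h]
      · intro c hc
        rw [mem_chains hρ] at hc
        rw [if_neg fun h0 => h (hc.eq_zero hρ h0), smul_zero]
  | succ k ih =>
    have hμL : ∀ i, L ≤ i → μ i = 0 := fun i hi => hμ i (by omega)
    simp only [schurSum, runSum]
    rw [Finset.sum_mul_sum]
    -- The power of `y k` from the tableau is moved to the right past the smaller letters of the
    -- runs, so that the induction hypothesis applies to the factors that precede it.
    have expand : ∀ f ∈ below L μ, ∀ m ∈ (box n ρ).filter (fun m => ∀ r, m (r + 1) ≤ t r),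
        (-1 : ℤ) ^ wordExp L f μ • (schurSum y L k f * y k ^ (size L μ - size L f)) *
        (-1 : ℤ) ^ runExp n m (fun r => ρ r - m r) •
          (runSum y n k (fun r => ρ r - m r) (fun r => t r - m (r + 1) + m r) * y k ^ size n m) =
        ∑ c ∈ chains L n f (fun r => ρ r - m r) (fun r => t r - m (r + 1) + m r),
          (-1 : ℤ) ^ (wordExp L f μ + runExp n m (fun r => ρ r - m r) +
            (size L μ - size L f) * size n (fun r => ρ r - m r) + chainExp L n c) •
            (schurSum y L k (c n) * y k ^ (size L μ - size L f + size n m)) := by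
      intro f hf m hm
      rw [mem_below hμL] at hf
      rw [smul_mul_smul_comm, ← pow_add, mul_assoc, ← mul_assoc (y k ^ _),
        mul_pow_anticomm _ (mul_runSum hy n le_rfl _ _), smul_mul_assoc, mul_smul_comm, smul_smul,
        ← pow_add, mul_assoc, ← pow_add, ← mul_assoc,
        ih f _ _ (fun i hi => Nat.le_zero.1 (hμ i hi ▸ (hf i).1))
          (fun r hr => by rw [hρ r hr, Nat.zero_sub]), Finset.sum_mul, Finset.smul_sum]
      refine Finset.sum_congr rfl fun c _ => ?_
      rw [smul_mul_assoc, smul_smul, ← pow_add]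
    rw [Finset.sum_congr rfl fun f hf => Finset.sum_congr rfl fun m hm => expand f hf m hm]
    simp only [Finset.smul_sum, Finset.sum_sigma']
    have source : ∀ f ∈ below L μ, ∀ m ∈ (box n ρ).filter (fun m => ∀ r, m (r + 1) ≤ t r),
        ∀ c ∈ chains L n f (fun r => ρ r - m r) (fun r => t r - m (r + 1) + m r),
        GrowthPair L c m (ascend c μ m) ∧ IsChain L μ ρ t (ascend c μ m) ∧ c 0 = f ∧
          ∀ r, n ≤ r → c r = c n := by
      intro f hf m hm c hc
      simp only [Finset.mem_filter, mem_box] at hm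
      rw [mem_below hμL] at hf
      have hρm : ∀ r, n ≤ r → ρ r - m r = 0 := fun r hr => by rw [hρ r hr, Nat.zero_sub]
      rw [mem_chains hρm] at hc
      have hcn := hc.eq_of_le hρm
      have hc0 := hc.start
      have hp := growthPair_ascend hL hc.strip
        (fun r hr => (hcn (r + 1) (by omega)).trans (hcn r hr).symm) (hc0 ▸ hf) hμ hm.1.2
      refine ⟨hp, ?_, hc0, hcn⟩
      rw [← hc0] at hc
      exact (hp.isChain_iff ρ t).2 ⟨hm.1.1, hm.2, hc⟩
    have target : ∀ c ∈ chains L n μ ρ t, ∀ f ∈ below L (c n), IsChain L μ ρ t c ∧ Strip f (c n) ∧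
        GrowthPair L (descend c f n)
          (fun r => c (r + 1) 0 - max (descend c f n (r + 1) 0) (c r 0)) c := by
      intro c hc f hf
      rw [mem_chains hρ] at hc
      rw [mem_below (hc.zero n)] at hf
      exact ⟨hc, hf, growthPair_descend hc.strip hc.zero (hc.eq_of_le hρ) hf⟩
    refine Finset.sum_bij' (fun x _ => ⟨ascend x.2.2 μ x.2.1, x.2.2 n⟩)
      (fun x _ => ⟨descend x.1 x.2 n 0, fun r => x.1 (r + 1) 0 -
        max (descend x.1 x.2 n (r + 1) 0) (x.1 r 0), descend x.1 x.2 n⟩) ?_ ?_ ?_ ?_ ?_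
    · rintro ⟨f, m, c⟩ hx
      simp only [Finset.mem_sigma] at hx ⊢
      obtain ⟨hp, hc, -, -⟩ := source f hx.1 m hx.2.1 c hx.2.2
      rw [mem_chains hρ, mem_below (hc.zero n)]
      exact ⟨hc, hp.strip n⟩
    · rintro ⟨c, f⟩ hx
      simp only [Finset.mem_sigma] at hx ⊢
      obtain ⟨hc, hf, hp⟩ := target c hx.1 f hx.2
      have hc0 := hc.start
      subst hc0
      obtain ⟨h1, h2, h3⟩ := (hp.isChain_iff ρ t).1 hc
      rw [mem_below hμL, Finset.mem_filter, mem_box, mem_chains]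
      · exact ⟨hp.strip 0, ⟨⟨h1, fun r hr => Nat.le_zero.1 ((h1 r).trans_eq (hρ r hr))⟩, h2⟩, h3⟩
      · intro r hr
        rw [hρ r hr, Nat.zero_sub]
    · rintro ⟨f, m, c⟩ hx
      simp only [Finset.mem_sigma] at hx
      obtain ⟨hp, hc, rfl, hcn⟩ := source f hx.1 m hx.2.1 c hx.2.2
      simp only
      rw [hp.descend_eq hcn]
      congr 2
      funext r
      rw [hp.grow_eq, grow_zero_sub]
    · rintro ⟨c, f⟩ hx
      simp only [Finset.mem_sigma] at hx
      obtain ⟨hc, hf, hp⟩ := target c hx.1 f hx.2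
      have hc0 := hc.start
      subst hc0
      simp only
      rw [hp.ascend_eq, descend_of_le c f le_rfl]
    · rintro ⟨f, m, c⟩ hx
      simp only [Finset.mem_sigma] at hx
      obtain ⟨hp, hc, rfl, hcn⟩ := source f hx.1 m hx.2.1 c hx.2.2
      have hm := hx.2.1
      simp only [Finset.mem_filter, mem_box] at hm
      simp only
      rw [smul_smul, ← pow_add]
      congr 1
      · refine negOne_pow_congr ?_
        have h2 : (2 : ZMod 2) = 0 := rfl
        have hc' := ((hp.isChain_iff ρ t).1 hc).2.2
        have := hp.parity hc'.size_eq n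
        simp only [ascend] at this
        push_cast at this ⊢
        generalize ((size L μ - size L (c 0) : ℕ) : ZMod 2) = d at *
        linear_combination this - ((chainExp L n (ascend c μ m) : ZMod 2) +
          wordExp L (c n) (ascend c μ m n)) * h2
      · rw [hp.size_sub n]
        rfl

end Ring

/-! ### Young diagrams from shapes -/

/-- The Young diagram with row lengths `f`, if `f` is weakly decreasing and supported
on `{0, …, L - 1}`. -/
def ofRows (L : ℕ) (f : ℕ → ℕ) : YoungDiagram where
  cells := (Finset.range L ×ˢ Finset.range (f 0)).filter fun b => ∀ i ≤ b.1, b.2 < f i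
  isLowerSet := by
    rintro ⟨i, j⟩ ⟨i', j'⟩ h hb
    obtain ⟨h1, h2⟩ : i' ≤ i ∧ j' ≤ j := h
    simp only [Finset.coe_filter, Finset.mem_product, Finset.mem_range, Set.mem_ofPred_eq] at hb ⊢
    exact ⟨⟨by omega, by omega⟩, fun p hp => by have := hb.2 p (by omega); omega⟩

theorem mem_ofRows {L : ℕ} {f : ℕ → ℕ} (hf : Antitone f) (h0 : ∀ i, L ≤ i → f i = 0) {i j : ℕ} :
    (i, j) ∈ ofRows L f ↔ j < f i := by
  rw [← YoungDiagram.mem_cells]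
  simp only [ofRows, Finset.mem_filter, Finset.mem_product, Finset.mem_range]
  constructor
  · exact fun h => h.2 i le_rfl
  · refine fun h => ⟨⟨?_, h.trans_le (hf (Nat.zero_le i))⟩, fun p hp => h.trans_le (hf hp)⟩
    by_contra hi
    rw [h0 i (by omega)] at h
    omega

theorem rowLen_ofRows {L : ℕ} {f : ℕ → ℕ} (hf : Antitone f) (h0 : ∀ i, L ≤ i → f i = 0) :
    (ofRows L f).rowLen = f := by
  funext i
  refine eq_of_forall_lt_iff fun j => ?_
  rw [← YoungDiagram.mem_iff_lt_rowLen, mem_ofRows hf h0]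

theorem rowLen_injective : Function.Injective YoungDiagram.rowLen := by
  intro κ κ' h
  ext ⟨i, j⟩
  rw [YoungDiagram.mem_cells, YoungDiagram.mem_cells, YoungDiagram.mem_iff_lt_rowLen,
    YoungDiagram.mem_iff_lt_rowLen, h]

theorem rowLen_eq_zero_iff {κ : YoungDiagram} {i : ℕ} : κ.rowLen i = 0 ↔ κ.colLen 0 ≤ i := by
  have h1 := YoungDiagram.mem_iff_lt_rowLen (μ := κ) (i := i) (j := 0)
  have h2 := YoungDiagram.mem_iff_lt_colLen (μ := κ) (i := i) (j := 0)
  rw [h1] at h2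
  omega

theorem Strip.antitone {f κ : ℕ → ℕ} (h : Strip f κ) : Antitone f :=
  antitone_nat_of_succ_le fun i => (h (i + 1)).1.trans (h i).2

/-! ### Row words -/

section Word

variable {R : Type*} [Ring R]

/-- The product over the row word of the filling `T` of the first `L` rows of a shape. -/
def rowProd (y : ℕ → R) (T : ℕ → ℕ → ℕ) (κ : ℕ → ℕ) : ℕ → R
  | 0 => 1
  | L + 1 => ((List.range (κ L)).map fun j => y (T L j)).prod * rowProd y T κ L

theorem rowProd_eq (y : ℕ → R) (T : ℕ → ℕ → ℕ) (κ : ℕ → ℕ) (L : ℕ) :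
    (((List.range L).reverse.flatMap fun i => (List.range (κ i)).map fun j => T i j).map y).prod =
      rowProd y T κ L := by
  induction L with
  | zero => simp [rowProd]
  | succ L ih =>
    rw [List.range_succ, List.reverse_append, rowProd, ← ih]
    simp [List.flatMap_cons, Function.comp_def]

theorem rowProd_of_le (y : ℕ → R) (T : ℕ → ℕ → ℕ) {κ : ℕ → ℕ} {L M : ℕ}
    (h : ∀ i, L ≤ i → κ i = 0) (hM : L ≤ M) : rowProd y T κ M = rowProd y T κ L := by
  induction M, hM using Nat.le_induction with
  | base => rfl
  | succ M hM ih => rw [rowProd, h M hM, ih]; simp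

theorem rowProd_congr (y : ℕ → R) {T T' : ℕ → ℕ → ℕ} {κ : ℕ → ℕ}
    (h : ∀ i j, j < κ i → T i j = T' i j) (L : ℕ) : rowProd y T κ L = rowProd y T' κ L := by
  induction L with
  | zero => rfl
  | succ L ih =>
    rw [rowProd, rowProd, ih]
    congr 2
    exact List.map_congr_left fun j hj => by rw [h L j (List.mem_range.1 hj)]

theorem mul_list_prod_anticomm {y : ℕ → R} (hy : ∀ i j, i ≠ j → y i * y j = -(y j * y i)) {N : ℕ}
    (w : List ℕ) (hw : ∀ a ∈ w, a ≠ N) :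
    y N * (w.map y).prod = (-1 : ℤ) ^ w.length • ((w.map y).prod * y N) := by
  induction w with
  | nil => simp
  | cons a w ih =>
    rw [List.map_cons, List.prod_cons, ← mul_assoc, hy N a (hw a (by simp)).symm, neg_mul, mul_assoc,
      ih fun b hb => hw b (by simp [hb]), List.length_cons, pow_succ, mul_smul_comm, mul_neg_one,
      neg_smul, mul_assoc]

theorem mul_rowProd_anticomm {y : ℕ → R} (hy : ∀ i j, i ≠ j → y i * y j = -(y j * y i)) {N : ℕ}
    {T : ℕ → ℕ → ℕ} {f : ℕ → ℕ} (hT : ∀ i j, j < f i → T i j ≠ N) (L : ℕ) :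
    y N * rowProd y T f L = (-1 : ℤ) ^ size L f • (rowProd y T f L * y N) := by
  induction L with
  | zero => simp [rowProd, size]
  | succ L ih =>
    have h1 := mul_list_prod_anticomm hy (N := N) ((List.range (f L)).map fun j => T L j) (by
      simpa using fun j hj => hT L j hj)
    simp only [List.map_map, Function.comp_def, List.length_map, List.length_range] at h1
    have e : size (L + 1) f = size L f + f L := Finset.sum_range_succ _ _
    rw [rowProd, ← mul_assoc, h1, smul_mul_assoc, mul_assoc, ih, mul_smul_comm, smul_smul, e,
      pow_add, mul_comm, mul_assoc]

/-- The letters `N` end their row and are followed in the row word by the rows above, whose own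
letters `N` have already been moved to the end. Those of row `L` therefore pass the `size L f`
smaller letters above. -/
theorem rowProd_strip {y : ℕ → R} (hy : ∀ i j, i ≠ j → y i * y j = -(y j * y i)) {N : ℕ}
    {T : ℕ → ℕ → ℕ} {f κ : ℕ → ℕ} (hf : ∀ i, f i ≤ κ i) (hT : ∀ i j, j < f i → T i j ≠ N)
    (hN : ∀ i j, f i ≤ j → j < κ i → T i j = N) (L : ℕ) :
    rowProd y T κ L = (-1 : ℤ) ^ wordExp L f κ •
      (rowProd y T f L * y N ^ (size L κ - size L f)) := by
  induction L with
  | zero => simp [rowProd, size, wordExp]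
  | succ L ih =>
    have e1 : size (L + 1) f = size L f + f L := Finset.sum_range_succ _ _
    have e2 : size (L + 1) κ = size L κ + κ L := Finset.sum_range_succ _ _
    have e3 : wordExp (L + 1) f κ = wordExp L f κ + (κ L - f L) * size L f :=
      Finset.sum_range_succ _ _
    have h1 : ((List.range (κ L)).map fun j => y (T L j)).prod =
        ((List.range (f L)).map fun j => y (T L j)).prod * y N ^ (κ L - f L) := by
      obtain ⟨d, hd⟩ := Nat.exists_eq_add_of_le (hf L)
      rw [hd, List.range_add, List.map_append, List.prod_append, Nat.add_sub_cancel_left]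
      congr 1
      rw [List.map_map]
      have : ∀ x ∈ List.range d, ((fun j => y (T L j)) ∘ fun x => f L + x) x = y N := by
        intro x hx
        simp only [Function.comp_apply]
        rw [hN L _ (by omega) (by have := List.mem_range.1 hx; omega)]
      rw [List.map_congr_left this]
      simp
    have h2 := size_mono hf L
    have h3 := hf L
    rw [rowProd, rowProd, ih, h1, mul_smul_comm, mul_assoc, ← mul_assoc (y N ^ _),
      mul_pow_anticomm _ (mul_rowProd_anticomm hy hT L), smul_mul_assoc, mul_smul_comm, smul_smul,
      ← pow_add, e1, e2, e3, mul_assoc, ← pow_add, mul_assoc]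
    congr 4
    omega

end Word

/-! ### Branching of tableaux -/

section Branching

variable {κ κ' : YoungDiagram}

/-- The row lengths of the part of a tableau with entries less than `N`. -/
def innerRow (T : SemistandardYoungTableau κ) (N i : ℕ) : ℕ :=
  Nat.find (p := fun j => ¬ ((i, j) ∈ κ ∧ T i j < N)) ⟨κ.rowLen i, fun h => by
    simpa using YoungDiagram.mem_iff_lt_rowLen.1 h.1⟩

theorem lt_innerRow {T : SemistandardYoungTableau κ} {N i j : ℕ} :
    j < innerRow T N i ↔ (i, j) ∈ κ ∧ T i j < N := by
  rw [innerRow, Nat.lt_find_iff]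
  simp only [not_not]
  refine ⟨fun h => h j le_rfl, fun h m hm => ⟨κ.up_left_mem le_rfl hm h.1, ?_⟩⟩
  exact (T.row_weak_of_le hm h.1).trans_lt h.2

theorem strip_innerRow {T : SemistandardYoungTableau κ} {N : ℕ} (hT : T ∈ boundedSSYT κ (N + 1)) :
    Strip (innerRow T N) κ.rowLen := by
  intro i
  constructor
  · refine le_of_forall_lt fun j hj => ?_
    exact YoungDiagram.mem_iff_lt_rowLen.1 (lt_innerRow.1 hj).1
  · refine le_of_forall_lt fun j hj => ?_
    have h1 := YoungDiagram.mem_iff_lt_rowLen.2 hj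
    have h2 := T.col_strict (show i < i + 1 by omega) h1
    have h3 := hT _ _ h1
    exact lt_innerRow.2 ⟨κ.up_left_mem (Nat.le_succ i) le_rfl h1, by omega⟩

/-- The restriction of a tableau to a smaller diagram. -/
def restrictTableau (T : SemistandardYoungTableau κ) (h : ∀ i j, (i, j) ∈ κ' → (i, j) ∈ κ) :
    SemistandardYoungTableau κ' where
  entry i j := if (i, j) ∈ κ' then T i j else 0
  row_weak' {i j₁ j₂} hj hm := by
    rw [if_pos hm, if_pos (κ'.up_left_mem le_rfl hj.le hm)]
    exact T.row_weak hj (h _ _ hm)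
  col_strict' {i₁ i₂ j} hi hm := by
    rw [if_pos hm, if_pos (κ'.up_left_mem hi.le le_rfl hm)]
    exact T.col_strict hi (h _ _ hm)
  zeros' hm := if_neg hm

/-- The extension of a tableau with entries less than `N` by a horizontal strip of entries `N`. -/
def extendTableau (T : SemistandardYoungTableau κ') (N : ℕ) (hT : T ∈ boundedSSYT κ' N)
    (h : ∀ i j, (i, j) ∈ κ' → (i, j) ∈ κ) (h' : ∀ i j, (i + 1, j) ∈ κ → (i, j) ∈ κ') :
    SemistandardYoungTableau κ where
  entry i j := if (i, j) ∈ κ' then T i j else if (i, j) ∈ κ then N else 0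
  row_weak' {i j₁ j₂} hj hm := by
    by_cases h2 : (i, j₂) ∈ κ'
    · rw [if_pos h2, if_pos (κ'.up_left_mem le_rfl hj.le h2)]
      exact T.row_weak hj h2
    · rw [if_neg h2, if_pos hm]
      split_ifs with h3
      · exact (hT _ _ h3).le
      · exact le_rfl
      · exact Nat.zero_le _
  col_strict' {i₁ i₂ j} hi hm := by
    obtain ⟨i₂, rfl⟩ : ∃ k, i₂ = k + 1 := ⟨i₂ - 1, by omega⟩
    have h1 : (i₁, j) ∈ κ' := κ'.up_left_mem (by omega) le_rfl (h' _ _ hm)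
    rw [if_pos h1]
    split_ifs with h2
    · exact T.col_strict hi h2
    · exact hT _ _ h1
  zeros' {i j} hm := by
    rw [if_neg fun hc => hm (h _ _ hc), if_neg hm]

theorem restrictTableau_apply (T : SemistandardYoungTableau κ)
    (h : ∀ i j, (i, j) ∈ κ' → (i, j) ∈ κ) (i j : ℕ) :
    restrictTableau T h i j = if (i, j) ∈ κ' then T i j else 0 := rfl

theorem extendTableau_apply (T : SemistandardYoungTableau κ') (N : ℕ) (hT : T ∈ boundedSSYT κ' N)
    (h : ∀ i j, (i, j) ∈ κ' → (i, j) ∈ κ) (h' : ∀ i j, (i + 1, j) ∈ κ → (i, j) ∈ κ') (i j : ℕ) :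
    extendTableau T N hT h h' i j =
      if (i, j) ∈ κ' then T i j else if (i, j) ∈ κ then N else 0 := rfl

end Branching

/-- The tableaux of shape `κ` with entries in `{0, …, N - 1}`, as a `Finset`. -/
noncomputable def tableaux (κ : YoungDiagram) (N : ℕ) : Finset (SemistandardYoungTableau κ) :=
  (finite_boundedSSYT κ N).toFinset

theorem mem_tableaux {κ : YoungDiagram} {N : ℕ} {T : SemistandardYoungTableau κ} :
    T ∈ tableaux κ N ↔ T ∈ boundedSSYT κ N := Set.Finite.mem_toFinset _

/-- Tableaux are grouped by the shape of their entries below `N`. The remaining boxes form a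
horizontal strip filled with `N`, so restriction and extension are inverse. -/
theorem sum_tableaux {R : Type*} [Ring R] {y : ℕ → R}
    (hy : ∀ i j, i ≠ j → y i * y j = -(y j * y i)) (L N : ℕ) (κ : YoungDiagram)
    (hκ : κ.colLen 0 ≤ L) :
    ∑ T ∈ tableaux κ N, rowProd y T κ.rowLen L = schurSum y L N κ.rowLen := by
  classical
  induction N generalizing κ with
  | zero =>
    simp only [schurSum]
    by_cases h : κ.rowLen = 0
    · have hκ0 : ∀ i j, (i, j) ∉ κ := fun i j hm => by
        rw [YoungDiagram.mem_iff_lt_rowLen, h] at hm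
        simp at hm
      have hT : ∀ T T' : SemistandardYoungTableau κ, T = T' := fun T T' => by
        ext i j
        rw [T.zeros (hκ0 i j), T'.zeros (hκ0 i j)]
      rw [if_pos h, h]
      have h1 : tableaux κ 0 = {default} := by
        ext T
        rw [mem_tableaux, Finset.mem_singleton]
        exact ⟨fun _ => hT _ _, fun _ i j hm => absurd hm (hκ0 i j)⟩
      rw [h1, Finset.sum_singleton]
      exact rowProd_of_le (L := 0) y _ (fun _ _ => rfl) (Nat.zero_le L)
    · rw [if_neg h]
      refine Finset.sum_eq_zero fun T hT => ?_
      rw [mem_tableaux] at hT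
      obtain ⟨i, hi⟩ := Function.ne_iff.1 h
      exact absurd (hT i 0 (YoungDiagram.mem_iff_lt_rowLen.2 (Nat.pos_of_ne_zero hi)))
        (Nat.not_lt_zero _)
  | succ N ih =>
    have hκ0 : ∀ i, L ≤ i → κ.rowLen i = 0 := fun i hi => rowLen_eq_zero_iff.2 (hκ.trans hi)
    rw [schurSum, ← Finset.sum_fiberwise_of_maps_to (s := tableaux κ (N + 1))
      (t := below L κ.rowLen) (g := fun T => innerRow T N)]
    swap
    · intro T hT
      rw [mem_tableaux] at hT
      exact (mem_below hκ0).2 (strip_innerRow hT)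
    refine Finset.sum_congr rfl fun f hf => ?_
    rw [mem_below hκ0] at hf
    have hf0 : ∀ i, L ≤ i → f i = 0 := fun i hi => Nat.le_zero.1 (hκ0 i hi ▸ (hf i).1)
    have hrow := rowLen_ofRows hf.antitone hf0
    have hcol : (ofRows L f).colLen 0 ≤ L := by
      rw [← rowLen_eq_zero_iff, hrow, hf0 L le_rfl]
    have hmem : ∀ i j, (i, j) ∈ ofRows L f ↔ j < f i := fun i j => mem_ofRows hf.antitone hf0
    have hsub : ∀ i j, (i, j) ∈ ofRows L f → (i, j) ∈ κ := fun i j h =>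
      YoungDiagram.mem_iff_lt_rowLen.2 (((hmem i j).1 h).trans_le (hf i).1)
    have hsup : ∀ i j, (i + 1, j) ∈ κ → (i, j) ∈ ofRows L f := fun i j h =>
      (hmem i j).2 ((YoungDiagram.mem_iff_lt_rowLen.1 h).trans_le (hf i).2)
    have hsrc : ∀ T ∈ (tableaux κ (N + 1)).filter (fun T => innerRow T N = f), ∀ i j,
        (j < f i ↔ (i, j) ∈ κ ∧ T i j < N) := by
      intro T hT i j
      rw [← (Finset.mem_filter.1 hT).2, lt_innerRow]
    have hle : ∀ T ∈ (tableaux κ (N + 1)).filter (fun T => innerRow T N = f), ∀ i j,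
        (i, j) ∈ κ → T i j < N + 1 := fun T hT =>
      mem_tableaux.1 (Finset.mem_filter.1 hT).1
    have hih := ih (ofRows L f) hcol
    rw [hrow] at hih
    rw [← hih, Finset.sum_mul, Finset.smul_sum]
    refine Finset.sum_bij' (fun T _ => restrictTableau T hsub)
      (fun T hT => extendTableau T N (mem_tableaux.1 hT) hsub hsup) ?_ ?_ ?_ ?_ ?_
    · intro T hT
      rw [mem_tableaux]
      intro i j hm
      rw [restrictTableau_apply, if_pos hm]
      exact ((hsrc T hT i j).1 ((hmem i j).1 hm)).2
    · intro T hT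
      rw [Finset.mem_filter, mem_tableaux]
      constructor
      · intro i j hm
        rw [extendTableau_apply]
        split_ifs with h
        · exact (mem_tableaux.1 hT i j h).trans (Nat.lt_succ_self N)
        · exact Nat.lt_succ_self N
      · funext i
        refine eq_of_forall_lt_iff fun j => ?_
        rw [lt_innerRow, extendTableau_apply, ← hmem]
        constructor
        · rintro ⟨h1, h2⟩
          by_contra h3
          rw [if_neg h3, if_pos h1] at h2
          omega
        · intro h
          rw [if_pos h]
          exact ⟨hsub i j h, mem_tableaux.1 hT i j h⟩
    · intro T hT
      ext i j
      rw [extendTableau_apply, restrictTableau_apply]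
      split_ifs with h1 h2
      · rfl
      · have h3 := hle T hT i j h2
        have h4 := mt (hsrc T hT i j).2 (mt (hmem i j).2 h1)
        have h5 : ¬ T i j < N := fun h => h4 ⟨h2, h⟩
        omega
      · rw [T.zeros h2]
    · intro T hT
      ext i j
      rw [restrictTableau_apply, extendTableau_apply]
      split_ifs with h1
      · rfl
      · rw [T.zeros h1]
    · intro T hT
      rw [rowProd_strip hy (N := N) (fun i => (hf i).1)
        (fun i j hj => (((hsrc T hT i j).1 hj).2).ne) (fun i j h1 h2 => ?_) L]
      · congr 2
        refine rowProd_congr y (fun i j hj => ?_) L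
        rw [restrictTableau_apply, if_pos ((hmem i j).2 hj)]
      · have h2 := YoungDiagram.mem_iff_lt_rowLen.2 h2
        have h3 := hle T hT i j h2
        have h5 : ¬ T i j < N := fun h => absurd ((hsrc T hT i j).2 ⟨h2, h⟩) (by omega)
        omega

/-! ### Odd Schur polynomials -/

theorem sign_mul_anticomm {R : Type*} [Ring R] {a b : R} (h : a * b = -(b * a)) (i j : ℕ) :
    (-1) ^ i * a * ((-1) ^ j * b) = -((-1) ^ j * b * ((-1) ^ i * a)) := by
  have c : ∀ (e : ℕ) (x : R), Commute ((-1) ^ e) x := fun e x => (Commute.neg_one_left x).pow_left e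
  rw [(c j a).symm.mul_mul_mul_comm, h, (c i b).symm.mul_mul_mul_comm, ← (c i ((-1) ^ j)).eq,
    mul_neg]

/-- Variables with index at least `N` are zero, which makes the relation hold for all distinct
indices. -/
theorem xTilde_anticomm (N i j : ℕ) (h : i ≠ j) :
    xTilde N i * xTilde N j = -(xTilde N j * xTilde N i) := by
  unfold xTilde
  split_ifs with hi hj
  · refine sign_mul_anticomm ?_ i j
    have h1 := RingQuot.mkRingHom_rel (SkewRel.anticomm (⟨i, hi⟩ : Fin N) ⟨j, hj⟩ (by simpa using h))
    rw [map_mul, RingHom.map_neg, map_mul] at h1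
    exact h1
  all_goals simp

theorem oddSchurPoly_eq (N L : ℕ) (κ : YoungDiagram) (hκ : κ.colLen 0 ≤ L) :
    oddSchurPoly N κ = (-1 : ℤ) ^ (directNorthCount κ + northCount κ) •
      schurSum (xTilde N) L N κ.rowLen := by
  rw [oddSchurPoly, zsmul_eq_mul, finsum_mem_eq_finite_toFinset_sum _ (finite_boundedSSYT κ N),
    ← sum_tableaux (xTilde_anticomm N) L N κ hκ]
  push_cast
  congr 1
  refine Finset.sum_congr rfl fun T _ => ?_
  rw [wordMonomial, rowWord, rowProd_eq]
  exact (rowProd_of_le _ _ (fun i hi => rowLen_eq_zero_iff.2 hi) hκ).symm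

/-! ### Linear independence -/

section Independence

open Finsupp

/-- The module with basis the exponents of monomials. -/
abbrev MonomialModule : Type := (ℕ →₀ ℕ) →₀ ℤ

/-- Left multiplication by the variable `y_i` on ordered monomials. -/
noncomputable def mulVar (i : ℕ) : Module.End ℤ MonomialModule :=
  Finsupp.linearCombination ℤ fun α =>
    (-1 : ℤ) ^ size i α • single (α + single i 1) 1

theorem mulVar_single (i : ℕ) (α : ℕ →₀ ℕ) :
    mulVar i (single α 1) = (-1 : ℤ) ^ size i α • single (α + single i 1) 1 := by
  simp [mulVar]

theorem size_add_single (k i d : ℕ) (α : ℕ →₀ ℕ) :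
    size k ⇑(α + single i d) = size k α + if i < k then d else 0 := by
  simp [size, Finset.sum_add_distrib, Finsupp.single_apply]

/-- The sign of `mulVar` counts the variables of smaller index. The two orders differ by one in this
count, for whichever of `i` and `j` is larger. -/
theorem mulVar_anticomm (i j : ℕ) (h : i ≠ j) : mulVar i * mulVar j = -(mulVar j * mulVar i) := by
  refine Finsupp.lhom_ext' fun α => LinearMap.ext_ring ?_
  simp only [LinearMap.comp_apply, Finsupp.lsingle_apply, Module.End.mul_apply, mulVar_single,
    map_zsmul, LinearMap.neg_apply, smul_smul, size_add_single]
  rw [add_right_comm, ← neg_smul]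
  congr 1
  rcases lt_or_gt_of_ne h with h | h
  · rw [if_pos h, if_neg h.le.not_gt]
    ring
  · rw [if_pos h, if_neg h.le.not_gt]
    ring

theorem mulVar_pow_single (i d : ℕ) (α : ℕ →₀ ℕ) (h : size i α = 0) :
    (mulVar i ^ d) (single α 1) = single (α + single i d) 1 := by
  induction d with
  | zero => simp
  | succ d ih =>
    rw [pow_succ', Module.End.mul_apply, ih, mulVar_single, size_add_single, h, if_neg (lt_irrefl i),
      add_assoc, ← Finsupp.single_add]
    simp

/-- The action of skew polynomials on monomials. -/
noncomputable def action (N : ℕ) : OPol N →ₐ[ℤ] Module.End ℤ MonomialModule :=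
  RingQuot.liftAlgHom ℤ ⟨FreeAlgebra.lift ℤ fun i : Fin N => (-1 : ℤ) ^ (i : ℕ) • mulVar i, by
    rintro _ _ ⟨i, j, h⟩
    simp only [map_mul, map_neg, FreeAlgebra.lift_ι_apply]
    rw [smul_mul_smul_comm, mulVar_anticomm i j (by simpa [Fin.ext_iff] using h),
      smul_mul_smul_comm, smul_neg, mul_comm]⟩

theorem action_xTilde {N k : ℕ} (h : k < N) : action N (xTilde N k) = mulVar k := by
  rw [xTilde, dif_pos h, map_mul, map_pow, map_neg, map_one]
  have h1 : RingQuot.mkRingHom (SkewRel N) (FreeAlgebra.ι ℤ ⟨k, h⟩) =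
      RingQuot.mkAlgHom ℤ (SkewRel N) (FreeAlgebra.ι ℤ ⟨k, h⟩) := by
    rw [← RingQuot.mkAlgHom_coe ℤ]
    rfl
  rw [h1, action, RingQuot.liftAlgHom_mkAlgHom_apply, FreeAlgebra.lift_ι_apply]
  have h2 : ((-1 : Module.End ℤ MonomialModule) ^ k) = (((-1 : ℤ) ^ k : ℤ) : _) := by push_cast; rfl
  rw [h2, ← zsmul_eq_mul, smul_smul, ← mul_pow]
  simp

/-! ### Dominance triangularity of the signed tableau sums -/

/-- The coefficient of a monomial in the product of a signed tableau sum and a monomial. -/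
noncomputable def schurCoeff (N L k : ℕ) (κ : ℕ → ℕ) (β γ : ℕ →₀ ℕ) : ℤ :=
  action N (schurSum (xTilde N) L k κ) (single β 1) γ

open Classical in
theorem schurCoeff_zero (N L : ℕ) (κ : ℕ → ℕ) (β γ : ℕ →₀ ℕ) :
    schurCoeff N L 0 κ β γ = if κ = 0 ∧ β = γ then 1 else 0 := by
  rw [schurCoeff, schurSum]
  by_cases h : κ = 0
  · simp [h, Finsupp.single_apply]
  · simp [h]

theorem schurCoeff_succ {N L k : ℕ} (hk : k < N) (κ : ℕ → ℕ) (β γ : ℕ →₀ ℕ) (hβ : size k β = 0) :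
    schurCoeff N L (k + 1) κ β γ = ∑ f ∈ below L κ, (-1 : ℤ) ^ wordExp L f κ *
      schurCoeff N L k f (β + single k (size L κ - size L f)) γ := by
  simp only [schurCoeff, schurSum, map_sum, map_zsmul, map_mul, map_pow, action_xTilde hk]
  rw [LinearMap.sum_apply, Finsupp.finsetSum_apply]
  refine Finset.sum_congr rfl fun f _ => ?_
  rw [LinearMap.smul_apply, Module.End.mul_apply, mulVar_pow_single _ _ _ hβ, Finsupp.smul_apply,
    smul_eq_mul]

theorem size_eq_size {κ : ℕ → ℕ} {k L : ℕ} (hk : ∀ i, k ≤ i → κ i = 0) (hL : ∀ i, L ≤ i → κ i = 0) :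
    size k κ = size L κ := by
  rcases le_total k L with h | h
  · exact Finset.sum_subset (by simpa using h) fun i _ hi => hk i (by simpa using hi)
  · exact (Finset.sum_subset (by simpa using h) fun i _ hi => hL i (by simpa using hi)).symm

theorem size_succ (k : ℕ) (κ : ℕ → ℕ) : size (k + 1) κ = size k κ + κ k := Finset.sum_range_succ _ _

/-- The letters below `j` of a tableau lie in its first `j` rows, so the content is dominated by the
shape. The monomial `β` carries the larger letters already peeled off. -/
theorem schurCoeff_ne_zero {N L k : ℕ} (hk : k ≤ N) {κ : ℕ → ℕ} (hκ : ∀ i, L ≤ i → κ i = 0)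
    {β γ : ℕ →₀ ℕ} (hβ : size k β = 0) (h : schurCoeff N L k κ β γ ≠ 0) :
    (∀ i, k ≤ i → γ i = β i) ∧ (∀ j ≤ k, size j γ ≤ size j κ) ∧ size k γ = size k κ ∧
      ∀ i, k ≤ i → κ i = 0 := by
  induction k generalizing κ β with
  | zero =>
    rw [schurCoeff_zero] at h
    have h' : κ = 0 ∧ β = γ := by
      by_contra hc
      exact h (if_neg hc)
    obtain ⟨rfl, rfl⟩ := h'
    simp [size]
  | succ k ih =>
    rw [size_succ] at hβ
    have hβk : size k β = 0 := by omega
    rw [schurCoeff_succ hk _ _ _ hβk] at h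
    obtain ⟨f, hf, hne⟩ := Finset.exists_ne_zero_of_sum_ne_zero h
    rw [mem_below hκ] at hf
    have hf0 : ∀ i, L ≤ i → f i = 0 := fun i hi => Nat.le_zero.1 (hκ i hi ▸ (hf i).1)
    obtain ⟨h1, h2, h3, h4⟩ := ih (by omega) hf0
      (by rw [size_add_single, hβk, if_neg (lt_irrefl k)]) (right_ne_zero_of_mul hne)
    have hκ' : ∀ i, k + 1 ≤ i → κ i = 0 := fun i hi => by
      obtain ⟨j, rfl⟩ : ∃ j, i = j + 1 := ⟨i - 1, by omega⟩
      exact Nat.le_zero.1 (h4 j (by omega) ▸ (hf j).2)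
    have h5 := size_eq_size h4 hf0
    have h6 := size_eq_size hκ' hκ
    have h7 := h1 k le_rfl
    simp only [Finsupp.add_apply, Finsupp.single_eq_same] at h7
    have h8 := size_mono (fun i => (hf i).1) L
    have h9 : size (k + 1) γ = size (k + 1) κ := by
      rw [size_succ]
      omega
    refine ⟨fun i hi => ?_, fun j hj => ?_, h9, hκ'⟩
    · rw [h1 i (by omega), Finsupp.add_apply, Finsupp.single_apply, if_neg (by omega), add_zero]
    · rcases Nat.lt_or_ge j (k + 1) with hj' | hj'
      · exact (h2 j (by omega)).trans (size_mono (fun i => (hf i).1) j)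
      · rw [le_antisymm hj hj', h9]

/-- Only one tableau has content equal to its shape, the one with `i` throughout row `i`; nothing
can cancel its contribution. Accordingly, peeling off the letter `k` must remove exactly row `k`,
which is the shape `f₀`. -/
theorem schurCoeff_self {N L k : ℕ} (hk : k ≤ N) {κ : ℕ → ℕ} (hanti : Antitone κ)
    (hκ : ∀ i, L ≤ i → κ i = 0) (hκk : ∀ i, k ≤ i → κ i = 0)
    {β γ : ℕ →₀ ℕ} (hβ : size k β = 0) (hγ : ∀ i, k ≤ i → γ i = β i) (hγκ : ∀ i < k, γ i = κ i) :
    schurCoeff N L k κ β γ ≠ 0 := by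
  induction k generalizing κ β with
  | zero =>
    rw [schurCoeff_zero, if_pos]
    · exact one_ne_zero
    · exact ⟨funext fun i => hκk i (Nat.zero_le i),
        Finsupp.ext fun i => (hγ i (Nat.zero_le i)).symm⟩
  | succ k ih =>
    rw [size_succ] at hβ
    have hβk : size k β = 0 := by omega
    rw [schurCoeff_succ hk _ _ _ hβk]
    set f₀ : ℕ → ℕ := fun i => if i < k then κ i else 0 with hf₀
    have hle : ∀ i, f₀ i ≤ κ i := fun i => by simp only [hf₀]; split_ifs <;> omega
    have hs : Strip f₀ κ := fun i => ⟨hle i, by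
      simp only [hf₀]
      split_ifs with hi
      · exact hanti (Nat.le_succ i)
      · exact (hκk (i + 1) (by omega)).le⟩
    have hf₀0 : ∀ i, L ≤ i → f₀ i = 0 := fun i hi => Nat.le_zero.1 (hκ i hi ▸ hle i)
    have hf₀k : ∀ i, k ≤ i → f₀ i = 0 := fun i hi => if_neg (by omega)
    have hsz : size k f₀ = size k κ := Finset.sum_congr rfl fun i hi =>
      if_pos (Finset.mem_range.1 hi)
    have e1 := size_eq_size hf₀k hf₀0
    have e2 := size_eq_size hκk hκ
    rw [size_succ] at e2
    have hd : size L κ - size L f₀ = κ k := by omega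
    rw [Finset.sum_eq_single f₀]
    · refine mul_ne_zero (pow_ne_zero _ (by norm_num)) (ih (by omega) hs.antitone hf₀0 hf₀k ?_ ?_ ?_)
      · rw [size_add_single, hβk, if_neg (lt_irrefl k)]
      · intro i hi
        rw [hd, Finsupp.add_apply, Finsupp.single_apply]
        split_ifs with h
        · subst h
          rw [hγκ k (Nat.lt_succ_self k)]
          omega
        · rw [hγ i (by omega), add_zero]
      · intro i hi
        rw [hγκ i (by omega)]
        exact (if_pos hi).symm
    · intro f hf hne
      by_contra h
      rw [mem_below hκ] at hf
      have hf0 : ∀ i, L ≤ i → f i = 0 := fun i hi => Nat.le_zero.1 (hκ i hi ▸ (hf i).1)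
      obtain ⟨-, -, h3, h4⟩ := schurCoeff_ne_zero (by omega) hf0
        (by rw [size_add_single, hβk, if_neg (lt_irrefl k)]) (right_ne_zero_of_mul h)
      have h5 : size k γ = size k κ := Finset.sum_congr rfl fun i hi =>
        hγκ i ((Finset.mem_range.1 hi).trans (Nat.lt_succ_self k))
      refine hne (eq_of_size_eq (L := k) (fun i => ?_) hf₀k (by rw [hsz, ← h3, h5]))
      simp only [hf₀]
      split_ifs with hi
      · exact (hf i).1
      · exact (h4 i (by omega)).le
    · exact fun h => absurd ((mem_below hκ).2 hs) h

theorem linearIndependent_oddSchur : LinearIndependent ℤ oddSchur := by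
  classical
  rw [linearIndependent_iff']
  intro s g hg
  by_contra! hc
  obtain ⟨κ₁, h1, h2⟩ := hc
  obtain ⟨N, hN⟩ : ∃ N, ∀ κ ∈ s, κ.colLen 0 ≤ N :=
    ⟨s.sup fun κ => κ.colLen 0, fun κ hκ => Finset.le_sup (f := fun κ => κ.colLen 0) hκ⟩
  -- The sum of all partial sums increases strictly in dominance order. Another shape of the support
  -- contributing to the monomial of a maximizer `κ₀` would dominate `κ₀`, hence have the same
  -- partial sums and equal it.
  obtain ⟨κ₀, hκ₀, hmax⟩ := Finset.exists_max_image (s.filter fun κ => g κ ≠ 0)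
    (fun κ => ∑ j ∈ Finset.range (N + 1), size j κ.rowLen) ⟨κ₁, by simp [h1, h2]⟩
  rw [Finset.mem_filter] at hκ₀
  have hz : ∀ κ ∈ s, ∀ i, N ≤ i → κ.rowLen i = 0 := fun κ hκ i hi =>
    rowLen_eq_zero_iff.2 ((hN κ hκ).trans hi)
  let γ : ℕ →₀ ℕ := Finsupp.onFinset (Finset.range N) κ₀.rowLen fun i hi => by
    rw [Finset.mem_range]
    by_contra h
    exact hi (hz κ₀ hκ₀.1 i (by omega))
  have hγ : ∀ i, γ i = κ₀.rowLen i := fun i => rfl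
  have hN0 := congrArg (fun x => action N x (single 0 1) γ) (congrFun hg N)
  simp only [Finset.sum_apply, Pi.smul_apply, map_sum, map_zsmul, Pi.zero_apply, map_zero,
    LinearMap.sum_apply, LinearMap.smul_apply, Finsupp.finsetSum_apply, Finsupp.smul_apply,
    LinearMap.zero_apply, Finsupp.zero_apply] at hN0
  rw [Finset.sum_eq_single_of_mem κ₀ hκ₀.1] at hN0
  · rw [oddSchur, oddSchurPoly_eq N N κ₀ (hN κ₀ hκ₀.1), map_zsmul, LinearMap.smul_apply,
      Finsupp.smul_apply, smul_eq_mul, smul_eq_mul] at hN0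
    have := schurCoeff_self (N := N) (L := N) (k := N) (β := 0) (γ := γ) le_rfl
      (fun i j h => κ₀.rowLen_anti i j h) (hz κ₀ hκ₀.1) (hz κ₀ hκ₀.1) (by simp [size])
      (fun i hi => by rw [hγ, hz κ₀ hκ₀.1 i hi]; rfl) (fun i _ => rfl)
    exact mul_ne_zero hκ₀.2 (mul_ne_zero (pow_ne_zero _ (by norm_num)) this) hN0
  · intro κ hκ hne
    by_contra h
    rw [smul_eq_mul] at h
    have hgκ := left_ne_zero_of_mul h
    have h3 := right_ne_zero_of_mul h
    rw [oddSchur, oddSchurPoly_eq N N κ (hN κ hκ), map_zsmul, LinearMap.smul_apply,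
      Finsupp.smul_apply, smul_eq_mul] at h3
    obtain ⟨-, h4, -, -⟩ := schurCoeff_ne_zero le_rfl (hz κ hκ) (by simp [size])
      (right_ne_zero_of_mul h3)
    have h5 : ∀ j ∈ Finset.range (N + 1), size j κ₀.rowLen ≤ size j κ.rowLen := fun j hj =>
      h4 j (Nat.lt_succ_iff.1 (Finset.mem_range.1 hj))
    have h6 := (Finset.sum_eq_sum_iff_of_le h5).1 (le_antisymm (Finset.sum_le_sum h5)
      (hmax κ (Finset.mem_filter.2 ⟨hκ, hgκ⟩)))
    refine hne (rowLen_injective (funext fun i => ?_))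
    rcases lt_or_ge i N with hi | hi
    · have h7 := h6 i (Finset.mem_range.2 (by omega))
      have h8 := h6 (i + 1) (Finset.mem_range.2 (by omega))
      rw [size_succ, size_succ] at h8
      omega
    · rw [hz κ hκ i hi, hz κ₀ hκ₀.1 i hi]

end Independence

/-! ### Box counts -/

theorem sum_cells {M : Type*} [AddCommMonoid M] (κ : YoungDiagram) {L : ℕ} (hκ : κ.colLen 0 ≤ L)
    (g : ℕ × ℕ → M) :
    ∑ b ∈ κ.cells, g b = ∑ i ∈ Finset.range L, ∑ j ∈ Finset.range (κ.rowLen i), g (i, j) := by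
  rw [Finset.sum_sigma']
  refine Finset.sum_bij' (fun b _ => ⟨b.1, b.2⟩) (fun x _ => (x.1, x.2)) ?_ ?_ ?_ ?_ ?_
  · rintro ⟨i, j⟩ hb
    rw [YoungDiagram.mem_cells, YoungDiagram.mem_iff_lt_rowLen] at hb
    simp only [Finset.mem_sigma, Finset.mem_range]
    refine ⟨?_, hb⟩
    by_contra h
    rw [rowLen_eq_zero_iff.2 (hκ.trans (not_lt.1 h))] at hb
    omega
  · rintro ⟨i, j⟩ hx
    simp only [Finset.mem_sigma, Finset.mem_range] at hx
    rw [YoungDiagram.mem_cells, YoungDiagram.mem_iff_lt_rowLen]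
    exact hx.2
  all_goals intros; rfl

theorem northCount_eq (κ : YoungDiagram) {L : ℕ} (hκ : κ.colLen 0 ≤ L) :
    northCount κ = ∑ i ∈ Finset.range L, κ.rowLen i * size i κ.rowLen := by
  rw [northCount, sum_cells κ hκ]
  refine Finset.sum_congr rfl fun i hi => ?_
  simp only
  rw [Finset.sum_const, Finset.card_range, smul_eq_mul, Finset.card_filter, sum_cells κ hκ]
  congr 1
  have h1 : ∀ p ∈ Finset.range L, ∑ j ∈ Finset.range (κ.rowLen p), (if p < i then 1 else 0) =
      if p < i then κ.rowLen p else 0 := fun p _ => by split_ifs <;> simp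
  rw [Finset.sum_congr rfl h1, ← Finset.sum_filter, size]
  refine Finset.sum_congr ?_ fun _ _ => rfl
  ext p
  simp only [Finset.mem_filter, Finset.mem_range] at hi ⊢
  omega

theorem directNorthCount_eq (κ : YoungDiagram) {L : ℕ} (hκ : κ.colLen 0 ≤ L) :
    directNorthCount κ = ∑ i ∈ Finset.range L, κ.rowLen i * i := by
  rw [directNorthCount, sum_cells κ hκ]
  refine Finset.sum_congr rfl fun i hi => ?_
  rw [Finset.sum_congr rfl (g := fun _ => i)]
  · simp
  · intro j hj
    rw [Finset.mem_range] at hj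
    have h1 : κ.cells.filter (fun b => b.1 < i ∧ b.2 = j) =
        (Finset.range i).image fun p => (p, j) := by
      ext ⟨p, q⟩
      simp only [Finset.mem_filter, YoungDiagram.mem_cells, Finset.mem_image, Finset.mem_range,
        Prod.mk.injEq]
      constructor
      · rintro ⟨-, h1, rfl⟩
        exact ⟨p, h1, rfl, rfl⟩
      · rintro ⟨p, h1, rfl, rfl⟩
        exact ⟨κ.up_left_mem h1.le le_rfl (YoungDiagram.mem_iff_lt_rowLen.2 hj), h1, rfl⟩
    rw [h1, Finset.card_image_of_injective _ fun a b h => (Prod.mk.inj h).1, Finset.card_range]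

/-! ### The expansion of a product -/

/-- In a Yamanouchi chain without defects, the strip `r` has no boxes above row `r`. -/
theorem IsChain.apply_succ_eq {L : ℕ} {μ ρ : ℕ → ℕ} {c : ℕ → ℕ → ℕ} (h : IsChain L μ ρ 0 c)
    {r i : ℕ} (hi : i < r) : c (r + 1) i = c r i := by
  induction r generalizing i with
  | zero => omega
  | succ r ih =>
    rcases lt_or_ge i L with hL | hL
    · have h1 := h.yam r i hL.le
      simp only [Pi.zero_apply, Nat.cast_zero] at h1
      have hs : ∀ q, c (r + 1) q ≤ c (r + 2) q := fun q => (h.strip (r + 1) q).1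
      -- By induction the preceding strip has no boxes in these rows, so the Yamanouchi bound is
      -- zero and a sum of nonnegative terms vanishes.
      rw [Finset.sum_eq_zero (s := Finset.range i), Finset.sum_range_succ] at h1
      · have h2 : 0 ≤ ∑ q ∈ Finset.range i, ((c (r + 2) q : ℤ) - c (r + 1) q) :=
          Finset.sum_nonneg fun q _ => by have := hs q; omega
        have h3 := hs i
        change c (r + 2) i = c (r + 1) i
        omega
      · intro q hq
        rw [Finset.mem_range] at hq
        rw [ih (by omega), sub_self]
    · rw [h.zero _ i hL, h.zero _ i hL]

/-- The chain that builds up a shape row by row. -/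
def rowChain (ν : ℕ → ℕ) (r i : ℕ) : ℕ := if i < r then ν i else 0

theorem rowChain_succ_sub (ν : ℕ → ℕ) (r i : ℕ) :
    rowChain ν (r + 1) i - rowChain ν r i = if i = r then ν r else 0 := by
  simp only [rowChain]
  by_cases h : i = r
  · subst h; simp
  · rw [if_neg h]
    split_ifs <;> omega

theorem rowChain_succ_sub_cast (ν : ℕ → ℕ) (r i : ℕ) :
    (rowChain ν (r + 1) i : ℤ) - rowChain ν r i = if i = r then (ν r : ℤ) else 0 := by
  simp only [rowChain]
  by_cases h : i = r
  · subst h; simp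
  · rw [if_neg h]
    split_ifs <;> omega

/-- Interlacing confines shape `r` to its first `r` rows, and the Yamanouchi condition keeps strip
`r` out of the rows above row `r`. Hence strip `r` lies in row `r`, and its size determines it. -/
theorem chains_start_zero {L n : ℕ} {ν : ℕ → ℕ} (hν : Antitone ν) (hn : ∀ i, n ≤ i → ν i = 0)
    (hnL : n ≤ L) : chains L n 0 ν 0 = {rowChain ν} := by
  have hL : ∀ i, L ≤ i → ν i = 0 := fun i hi => hn i (hnL.trans hi)
  have hsize : ∀ r, size L (rowChain ν (r + 1)) = size L (rowChain ν r) + ν r := by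
    intro r
    have h1 : size L (rowChain ν (r + 1)) =
        size L (rowChain ν r) + ∑ i ∈ Finset.range L, if i = r then ν r else 0 := by
      rw [size, size, ← Finset.sum_add_distrib]
      refine Finset.sum_congr rfl fun i _ => ?_
      rw [← rowChain_succ_sub]
      simp only [rowChain]
      split_ifs <;> omega
    rw [h1, Finset.sum_ite_eq']
    split_ifs with h
    · rfl
    · rw [hL r (by simpa using h)]
  ext c
  rw [mem_chains hn, Finset.mem_singleton]
  constructor
  · intro h
    have h0 : ∀ r i, r ≤ i → c r i = 0 := by
      intro r
      induction r with
      | zero => intro i _; rw [h.start]; rfl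
      | succ r ih =>
        intro i hi
        obtain ⟨j, rfl⟩ : ∃ j, i = j + 1 := ⟨i - 1, by omega⟩
        exact Nat.le_zero.1 (ih j (by omega) ▸ (h.strip r j).2)
    funext r
    induction r with
    | zero => rw [h.start]; rfl
    | succ r ih =>
      funext i
      rcases lt_trichotomy i r with hi | rfl | hi
      · rw [h.apply_succ_eq hi, ih]
        simp only [rowChain]
        rw [if_pos hi, if_pos (by omega)]
      · rcases lt_or_ge i L with hiL | hiL
        · have h1 := h.size_eq i
          rw [ih, ← hsize i] at h1
          have h2 : ∀ j ∈ (Finset.range L).erase i, c (i + 1) j = rowChain ν (i + 1) j := by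
            intro j hj
            rw [Finset.mem_erase] at hj
            rcases lt_or_gt_of_ne hj.1 with hj' | hj'
            · rw [h.apply_succ_eq hj', ih]
              simp only [rowChain]
              rw [if_pos hj', if_pos (by omega)]
            · rw [h0 (i + 1) j (by omega), rowChain, if_neg (by omega)]
          have e1 : size L (c (i + 1)) =
              ∑ j ∈ (Finset.range L).erase i, rowChain ν (i + 1) j + c (i + 1) i := by
            rw [← Finset.sum_congr rfl h2]
            exact (Finset.sum_erase_add _ _ (Finset.mem_range.2 hiL)).symm
          have e2 : size L (rowChain ν (i + 1)) =
              ∑ j ∈ (Finset.range L).erase i, rowChain ν (i + 1) j + rowChain ν (i + 1) i :=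
            (Finset.sum_erase_add _ _ (Finset.mem_range.2 hiL)).symm
          omega
        · rw [h.zero _ _ hiL, rowChain, hL i hiL, ite_self]
      · rw [h0 (r + 1) i (by omega), rowChain, if_neg (by omega)]
  · rintro rfl
    refine ⟨?_, fun r i => ?_, fun r i hi => ?_, hsize, fun r j _ => ?_⟩
    · funext i; simp [rowChain]
    · have := hν (show i ≤ i + 1 by omega)
      simp only [rowChain]
      split_ifs <;> omega
    · rw [rowChain, hL i hi, ite_self]
    · simp only [rowChain_succ_sub_cast, Finset.sum_ite_eq', Finset.mem_range, Pi.zero_apply]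
      have := hν (show r ≤ r + 1 by omega)
      split_ifs <;> omega

theorem chainExp_rowChain {L n : ℕ} {ν : ℕ → ℕ} (hnL : n ≤ L) :
    chainExp L n (rowChain ν) = ∑ r ∈ Finset.range n, ν r * ∑ p ∈ Finset.range r, (ν p + 1) := by
  refine Finset.sum_congr rfl fun r hr => ?_
  simp only [insExp, rowChain_succ_sub, ite_mul, zero_mul]
  rw [Finset.sum_ite_eq', if_pos (by simp at hr ⊢; omega)]
  congr 1
  refine Finset.sum_congr rfl fun p hp => ?_
  rw [rowChain, if_pos (Finset.mem_range.1 hp)]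

/-- The sign in the definition of the odd Schur polynomial is thus the insertion sign of `rowChain`,
compare `chainExp_rowChain`. -/
theorem directNorthCount_add_northCount (κ : YoungDiagram) {L : ℕ} (hκ : κ.colLen 0 ≤ L) :
    directNorthCount κ + northCount κ =
      ∑ i ∈ Finset.range L, κ.rowLen i * ∑ p ∈ Finset.range i, (κ.rowLen p + 1) := by
  rw [directNorthCount_eq κ hκ, northCount_eq κ hκ, ← Finset.sum_add_distrib]
  refine Finset.sum_congr rfl fun i _ => ?_
  rw [Finset.sum_add_distrib, size]
  simp
  ring

theorem rowLen_antitone (κ : YoungDiagram) : Antitone κ.rowLen := fun i j h => κ.rowLen_anti i j h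

theorem rowLen_eq_zero {κ : YoungDiagram} {n i : ℕ} (h : κ.colLen 0 ≤ n) (hi : n ≤ i) :
    κ.rowLen i = 0 := rowLen_eq_zero_iff.2 (h.trans hi)

theorem schurSum_zero {R : Type*} [Ring R] (y : ℕ → R) (L k : ℕ) : schurSum y L k 0 = 1 := by
  induction k with
  | zero => simp [schurSum]
  | succ k ih =>
    have h1 : below L 0 = {0} := by
      ext f
      rw [mem_below (κ := 0) fun _ _ => rfl, Finset.mem_singleton]
      constructor
      · exact fun h => funext fun i => Nat.le_zero.1 (h i).1
      · rintro rfl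
        exact fun i => by simp
    rw [schurSum, h1, Finset.sum_singleton, ih]
    simp [wordExp]

/-- An odd Schur polynomial as a sum over sequences of runs. -/
theorem runSum_eq_oddSchurPoly (N n : ℕ) (ν : YoungDiagram) (hν : ν.colLen 0 ≤ n) :
    runSum (xTilde N) n N ν.rowLen 0 = oddSchurPoly N ν := by
  have h0 : ∀ i, n ≤ i → ν.rowLen i = 0 := fun i hi => rowLen_eq_zero hν hi
  -- The runs are inserted into the empty tableau, where a single chain is possible.
  have key := schurSum_mul_runSum (xTilde_anticomm N) (L := n) (L₀ := 0) (n := n) (by omega) N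
    0 ν.rowLen 0 (fun _ _ => rfl) h0
  rw [schurSum_zero, one_mul, chains_start_zero (rowLen_antitone ν) h0 le_rfl,
    Finset.sum_singleton, chainExp_rowChain le_rfl] at key
  have h1 : rowChain ν.rowLen n = ν.rowLen := by
    funext i
    rw [rowChain]
    split_ifs with h
    · rfl
    · rw [h0 i (by omega)]
  rw [key, oddSchurPoly_eq N n ν hν, directNorthCount_add_northCount ν hν, h1]

/-- Each summand receives a squared sign, which will turn the tableau sum of the final shape into an
odd Schur polynomial. -/
theorem signed_schurSum_mul_runSum {R : Type*} [Ring R] {y : ℕ → R}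
    (hy : ∀ i j, i ≠ j → y i * y j = -(y j * y i)) {L L₀ n : ℕ} (hL : L₀ + n ≤ L) (k : ℕ)
    (μ ρ t : ℕ → ℕ) (hμ : ∀ i, L₀ ≤ i → μ i = 0) (hρ : ∀ r, n ≤ r → ρ r = 0) (a : ℕ)
    (b : (ℕ → ℕ → ℕ) → ℕ) :
    (-1 : ℤ) ^ a • schurSum y L k μ * runSum y n k ρ t =
      ∑ c ∈ chains L n μ ρ t, (-1 : ℤ) ^ (a + chainExp L n c + b c) •
        ((-1 : ℤ) ^ b c • schurSum y L k (c n)) := by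
  rw [smul_mul_assoc, schurSum_mul_runSum hy hL k μ ρ t hμ hρ, Finset.smul_sum]
  refine Finset.sum_congr rfl fun c _ => ?_
  rw [smul_smul, smul_smul, ← pow_add, ← pow_add]
  congr 1
  refine negOne_pow_congr ?_
  push_cast
  have h2 : (2 : ZMod 2) = 0 := rfl
  linear_combination -(b c : ZMod 2) * h2

/-- The bound `n + n` on the rows comes from the at most `n` rows of `μ` and at most one new row for
each of the `n` strips. -/
theorem oddSchurPoly_mul (N n : ℕ) (μ ν : YoungDiagram) (hμ : μ.colLen 0 ≤ n)
    (hν : ν.colLen 0 ≤ n) :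
    oddSchurPoly N μ * oddSchurPoly N ν = ∑ c ∈ chains (n + n) n μ.rowLen ν.rowLen 0,
      (-1 : ℤ) ^ (directNorthCount μ + northCount μ + chainExp (n + n) n c +
        (directNorthCount (ofRows (n + n) (c n)) + northCount (ofRows (n + n) (c n)))) •
        oddSchurPoly N (ofRows (n + n) (c n)) := by
  have h0 : ∀ i, n ≤ i → ν.rowLen i = 0 := fun i hi => rowLen_eq_zero hν hi
  rw [← runSum_eq_oddSchurPoly N n ν hν, oddSchurPoly_eq N (n + n) μ (by omega)]
  refine (signed_schurSum_mul_runSum (xTilde_anticomm N) le_rfl N μ.rowLen ν.rowLen _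
      (fun i hi => rowLen_eq_zero hμ hi) h0 _ fun c => directNorthCount (ofRows (n + n) (c n)) +
        northCount (ofRows (n + n) (c n))).trans ?_
  refine Finset.sum_congr rfl fun c hc => ?_
  rw [mem_chains h0] at hc
  have h1 := rowLen_ofRows (hc.strip n).antitone (hc.zero n)
  have h2 : (ofRows (n + n) (c n)).colLen 0 ≤ n + n := by
    rw [← rowLen_eq_zero_iff, h1, hc.zero n _ le_rfl]
  rw [oddSchurPoly_eq N (n + n) (ofRows (n + n) (c n)) h2, h1]

/-- The expansion of a product of odd Schur functions, as a sum over chains. -/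
noncomputable def chainExpansion (n : ℕ) (μ ν : YoungDiagram) : YoungDiagram →₀ ℤ :=
  ∑ c ∈ chains (n + n) n μ.rowLen ν.rowLen 0, Finsupp.single (ofRows (n + n) (c n))
    ((-1 : ℤ) ^ (directNorthCount μ + northCount μ + chainExp (n + n) n c +
        (directNorthCount (ofRows (n + n) (c n)) + northCount (ofRows (n + n) (c n)))))

theorem oddSchur_mul (n : ℕ) (μ ν : YoungDiagram) (hμ : μ.colLen 0 ≤ n) (hν : ν.colLen 0 ≤ n) :
    oddSchur μ * oddSchur ν = Finsupp.linearCombination ℤ oddSchur (chainExpansion n μ ν) := by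
  funext N
  rw [chainExpansion, map_sum, Finset.sum_apply, Pi.mul_apply, oddSchur, oddSchur,
    oddSchurPoly_mul N n μ ν hμ hν]
  refine Finset.sum_congr rfl fun c _ => ?_
  rw [Finsupp.linearCombination_single, Pi.smul_apply, oddSchur]

theorem oddSchur_mul_eq_linearCombination (n : ℕ) (μ ν : YoungDiagram) (hμ : μ.colLen 0 ≤ n)
    (hν : ν.colLen 0 ≤ n) :
    oddSchur μ * oddSchur ν = Finsupp.linearCombination ℤ oddSchur (oddLRExpansion μ ν) := by
  have h : ∃ c : YoungDiagram →₀ ℤ,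
      oddSchur μ * oddSchur ν = Finsupp.linearCombination ℤ oddSchur c :=
    ⟨_, oddSchur_mul n μ ν hμ hν⟩
  rw [oddLRExpansion, dif_pos h]
  exact h.choose_spec

theorem oddLRExpansion_eq (n : ℕ) (μ ν : YoungDiagram) (hμ : μ.colLen 0 ≤ n)
    (hν : ν.colLen 0 ≤ n) : oddLRExpansion μ ν = chainExpansion n μ ν :=
  linearIndependent_oddSchur (((oddSchur_mul_eq_linearCombination n μ ν hμ hν).symm.trans
    (oddSchur_mul n μ ν hμ hν)))

open Classical in
theorem oddLRCoeff_eq (n : ℕ) (lam μ ν : YoungDiagram)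
    (hμ : μ.colLen 0 ≤ n) (hν : ν.colLen 0 ≤ n) :
    oddLRCoeff μ ν lam = ∑ c ∈ chains (n + n) n μ.rowLen ν.rowLen 0 with c n = lam.rowLen,
      (-1 : ℤ) ^ (directNorthCount μ + northCount μ + chainExp (n + n) n c +
        (directNorthCount lam + northCount lam)) := by
  rw [oddLRCoeff, oddLRExpansion_eq n μ ν hμ hν, chainExpansion, Finsupp.finsetSum_apply,
    Finset.sum_filter]
  refine Finset.sum_congr rfl fun c hc => ?_
  rw [mem_chains fun i hi => rowLen_eq_zero hν hi] at hc
  have h1 := rowLen_ofRows (hc.strip n).antitone (hc.zero n)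
  rw [Finsupp.single_apply]
  by_cases h : c n = lam.rowLen
  · have h2 : ofRows (n + n) (c n) = lam := rowLen_injective (h1.trans h)
    rw [if_pos h, if_pos h2, h2]
  · rw [if_neg h, if_neg]
    rintro h2
    exact h (by rw [← h1, h2])

/-! ### Littlewood–Richardson triangles and chains -/

section Triangles

variable {n : ℕ}

theorem Triangle.at_of_le {R : Type*} [Zero R] (A : Triangle n R) {i j : ℕ} (h : i ≤ j) (h' : j ≤ n) :
    A.at i j = A ⟨(i, j), h, h'⟩ := dif_pos ⟨h, h'⟩

theorem Triangle.at_of_lt {R : Type*} [Zero R] (A : Triangle n R) {i j : ℕ} (h : j < i) :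
    A.at i j = 0 := dif_neg fun hc => by omega

theorem Triangle.at_of_gt {R : Type*} [Zero R] (A : Triangle n R) {i j : ℕ} (h : n < j) :
    A.at i j = 0 := dif_neg fun hc => by omega

theorem Triangle.at_cast (A : Triangle n ℤ) (i j : ℕ) :
    Triangle.at (fun p => (A p : ℝ)) i j = (A.at i j : ℝ) := by
  unfold Triangle.at
  split_ifs <;> simp

/-- Passes from the columns of a triangle, numbered from `1`, to the rows of a shape, numbered from
`0`; entries left of the diagonal are zero, so the lower limit is immaterial. -/
theorem sum_Icc_eq_sum_range {R : Type*} [AddCommMonoid R] {f : ℕ → R} {i : ℕ} (h0 : f 0 = 0)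
    (h : ∀ q < i, f q = 0) (m : ℕ) :
    ∑ q ∈ Finset.Icc i m, f q = ∑ q ∈ Finset.range m, f (q + 1) := by
  have h2 := Finset.sum_range_succ' f m
  rw [h0, add_zero] at h2
  rw [← h2]
  refine Finset.sum_subset (fun q hq => ?_) fun q hq hq' => h q ?_
  · simp only [Finset.mem_Icc, Finset.mem_range] at hq ⊢
    omega
  · simp only [Finset.mem_Icc, Finset.mem_range] at hq hq'
    omega

theorem Triangle.at_zero_right {R : Type*} [Zero R] (A : Triangle n R) (h0 : A.at 0 0 = 0) (i : ℕ) :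
    A.at i 0 = 0 := by
  rcases Nat.eq_zero_or_pos i with rfl | h
  · exact h0
  · exact A.at_of_lt h

theorem Triangle.sum_Icc_eq {R : Type*} [AddCommMonoid R] (A : Triangle n R) (h0 : A.at 0 0 = 0)
    (i m : ℕ) :
    ∑ q ∈ Finset.Icc i m, A.at i q = ∑ q ∈ Finset.range m, A.at i (q + 1) :=
  sum_Icc_eq_sum_range (A.at_zero_right h0 i) (fun _ h => A.at_of_lt h) m

/-- Integral Littlewood–Richardson triangles with prescribed partitions. -/
structure IsIntegralLR (lam μ ν : YoungDiagram) (A : Triangle n ℤ) : Prop where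
  apex : A.at 0 0 = 0
  nonneg : ∀ i j, 1 ≤ i → i < j → j ≤ n → 0 ≤ A.at i j
  column_strict : ∀ i j, 1 ≤ i → i ≤ j → j < n →
    ∑ p ∈ Finset.range (i + 1), A.at p (j + 1) ≤ ∑ p ∈ Finset.range i, A.at p j
  yamanouchi : ∀ i j, 1 ≤ i → i ≤ j → j < n →
    ∑ q ∈ Finset.range (j + 1), A.at (i + 1) (q + 1) ≤ ∑ q ∈ Finset.range j, A.at i (q + 1)
  lam_eq : ∀ j, 1 ≤ j → j ≤ n → (part lam j : ℤ) = ∑ p ∈ Finset.range (j + 1), A.at p j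
  mu_eq : ∀ j, 1 ≤ j → j ≤ n → (part μ j : ℤ) = A.at 0 j
  nu_eq : ∀ i, 1 ≤ i → i ≤ n → (part ν i : ℤ) = ∑ q ∈ Finset.range n, A.at i (q + 1)

theorem mem_integerPoints_lrPolytope {lam μ ν : YoungDiagram} {A : Triangle n ℤ} :
    A ∈ integerPoints (lrPolytope n lam μ ν) ↔ IsIntegralLR lam μ ν A := by
  change (IsLRTriangle (fun p => (A p : ℝ)) ∧ _) ↔ _
  constructor
  · rintro ⟨⟨h1, h2, h3, h4⟩, h5, h6, h7⟩
    simp only [Triangle.at_cast] at h1 h2 h3 h4 h5 h6 h7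
    have h0 : A.at 0 0 = 0 := by exact_mod_cast h1
    refine ⟨h0, fun i j a b c => by exact_mod_cast h2 i j a b c,
      fun i j a b c => by exact_mod_cast h3 i j a b c, fun i j a b c => ?_,
      fun j a b => by exact_mod_cast h5 j a b, fun j a b => by exact_mod_cast h6 j a b,
      fun i a b => ?_⟩
    · rw [← A.sum_Icc_eq h0, ← A.sum_Icc_eq h0]
      exact_mod_cast h4 i j a b c
    · rw [← A.sum_Icc_eq h0]
      exact_mod_cast h7 i a b
  · rintro ⟨h0, h2, h3, h4, h5, h6, h7⟩
    simp only [← A.sum_Icc_eq h0] at h4 h7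
    refine ⟨⟨?_, ?_, ?_, ?_⟩, ?_, ?_, ?_⟩ <;> simp only [Triangle.at_cast]
    · exact_mod_cast h0
    · exact fun i j a b c => by exact_mod_cast h2 i j a b c
    · exact fun i j a b c => by exact_mod_cast h3 i j a b c
    · exact fun i j a b c => by exact_mod_cast h4 i j a b c
    · exact fun j a b => by exact_mod_cast h5 j a b
    · exact fun j a b => by exact_mod_cast h6 j a b
    · exact fun i a b => by exact_mod_cast h7 i a b

/-- The chain of shapes of a Littlewood–Richardson triangle. -/
def chainOf (A : Triangle n ℤ) (r i : ℕ) : ℕ := (∑ p ∈ Finset.range (r + 1), A.at p (i + 1)).toNat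

/-- The triangle of a chain of shapes. -/
def triangleOf (n : ℕ) (c : ℕ → ℕ → ℕ) : Triangle n ℤ := fun x =>
  if x.1.1 = 0 then (if x.1.2 = 0 then 0 else (c 0 (x.1.2 - 1) : ℤ))
  else (c x.1.1 (x.1.2 - 1) : ℤ) - c (x.1.1 - 1) (x.1.2 - 1)

/-! ### From integral triangles to chains -/

namespace IsIntegralLR

variable {lam μ ν : YoungDiagram} {A : Triangle n ℤ}

/-- Positivity is imposed only off the diagonal. On it, the Yamanouchi inequalities with `j = i`
make the entries decrease down to the last one, which is the part `n` of `ν`. -/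
theorem diag_nonneg (h : IsIntegralLR lam μ ν A) {i : ℕ} (hi : 1 ≤ i) (hin : i ≤ n) :
    0 ≤ A.at i i := by
  have single : ∀ i, 1 ≤ i → ∑ q ∈ Finset.range i, A.at i (q + 1) = A.at i i := by
    intro i hi
    obtain ⟨k, rfl⟩ : ∃ k, i = k + 1 := ⟨i - 1, by omega⟩
    rw [Finset.sum_range_succ, Finset.sum_eq_zero, zero_add]
    exact fun q hq => A.at_of_lt (by rw [Finset.mem_range] at hq; omega)
  induction hin using Nat.decreasingInduction with
  | self =>
    rw [← single n hi, ← h.nu_eq n hi le_rfl]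
    exact Int.natCast_nonneg _
  | of_succ i hin ih =>
    refine (ih (by omega)).trans ?_
    rw [← single i hi, ← single (i + 1) (by omega)]
    exact h.yamanouchi i i hi le_rfl hin

theorem nonneg' (h : IsIntegralLR lam μ ν A) (i j : ℕ) : 0 ≤ A.at i j := by
  rcases lt_or_ge n j with hj | hj
  · rw [A.at_of_gt hj]
  rcases lt_trichotomy i j with hij | rfl | hij
  · rcases Nat.eq_zero_or_pos i with rfl | hi
    · rw [← h.mu_eq j hij hj]
      exact Int.natCast_nonneg _
    · exact h.nonneg i j hi hij hj
  · rcases Nat.eq_zero_or_pos i with rfl | hi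
    · exact h.apex.ge
    · exact h.diag_nonneg hi hj
  · rw [A.at_of_lt hij]

theorem cast_chainOf (h : IsIntegralLR lam μ ν A) (r i : ℕ) :
    (chainOf A r i : ℤ) = ∑ p ∈ Finset.range (r + 1), A.at p (i + 1) :=
  Int.toNat_of_nonneg (Finset.sum_nonneg fun _ _ => h.nonneg' _ _)

theorem cast_chainOf_succ (h : IsIntegralLR lam μ ν A) (r i : ℕ) :
    (chainOf A (r + 1) i : ℤ) = chainOf A r i + A.at (r + 1) (i + 1) := by
  rw [h.cast_chainOf, h.cast_chainOf, Finset.sum_range_succ]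

theorem _root_.OddLR.chainOf_of_le {r i : ℕ} (hr : n ≤ i) : chainOf A r i = 0 := by
  rw [chainOf, Finset.sum_eq_zero fun p _ => A.at_of_gt (by omega)]
  rfl

/-- Column `i + 1` has no entries below the diagonal, so its sum is already complete when `i < r`.
-/
theorem chainOf_of_lt (h : IsIntegralLR lam μ ν A) (hlam : lam.colLen 0 ≤ n) {r i : ℕ}
    (hr : i < r) : chainOf A r i = lam.rowLen i := by
  rcases lt_or_ge i n with hi | hi
  · have h1 := h.lam_eq (i + 1) (by omega) hi
    have h2 : ∑ p ∈ Finset.range (r + 1), A.at p (i + 1) =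
        ∑ p ∈ Finset.range (i + 1 + 1), A.at p (i + 1) := by
      refine (Finset.sum_subset (by simpa using hr) fun p _ hp => A.at_of_lt ?_).symm
      simpa using hp
    have h3 := h.cast_chainOf r i
    rw [h2, ← h1] at h3
    exact_mod_cast h3
  · rw [chainOf_of_le hi, rowLen_eq_zero hlam hi]

theorem isChain (h : IsIntegralLR lam μ ν A) (hlam : lam.colLen 0 ≤ n) (hμ : μ.colLen 0 ≤ n)
    (hν : ν.colLen 0 ≤ n) : IsChain (n + n) μ.rowLen ν.rowLen 0 (chainOf A) := by
  refine ⟨?_, fun r i => ⟨?_, ?_⟩, fun r i hi => chainOf_of_le (by omega), fun r => ?_,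
    fun r j _ => ?_⟩
  · funext i
    rcases lt_or_ge i n with hi | hi
    · have h1 := h.mu_eq (i + 1) (by omega) hi
      have h2 := h.cast_chainOf 0 i
      rw [zero_add, Finset.sum_range_one, ← h1] at h2
      exact_mod_cast h2
    · rw [chainOf_of_le hi, rowLen_eq_zero hμ hi]
  · have h1 := h.cast_chainOf_succ r i
    have h2 := h.nonneg' (r + 1) (i + 1)
    omega
  · rcases lt_or_ge i r with hr | hr
    · rw [h.chainOf_of_lt hlam hr, h.chainOf_of_lt hlam (by omega)]
      exact rowLen_antitone lam (Nat.le_succ i)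
    · rcases lt_or_ge (i + 1) n with hi | hi
      · have h1 := h.column_strict (r + 1) (i + 1) (by omega) (by omega) hi
        rw [← h.cast_chainOf, ← h.cast_chainOf] at h1
        exact_mod_cast h1
      · rw [chainOf_of_le hi]
        exact Nat.zero_le _
  · have h1 : (size (n + n) (chainOf A (r + 1)) : ℤ) = size (n + n) (chainOf A r) +
        ∑ i ∈ Finset.range (n + n), A.at (r + 1) (i + 1) := by
      simp only [size, Nat.cast_sum]
      rw [← Finset.sum_add_distrib]
      exact Finset.sum_congr rfl fun i _ => h.cast_chainOf_succ r i
    have h2 : ∑ i ∈ Finset.range (n + n), A.at (r + 1) (i + 1) = (ν.rowLen r : ℤ) := by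
      rcases lt_or_ge r n with hr | hr
      · have h3 := h.nu_eq (r + 1) (by omega) hr
        rw [part, Nat.add_sub_cancel] at h3
        rw [h3]
        refine (Finset.sum_subset (by simp) fun i _ hi => A.at_of_gt ?_).symm
        simp at hi
        omega
      · rw [rowLen_eq_zero hν hr]
        refine Finset.sum_eq_zero fun i _ => ?_
        rcases lt_or_ge n (i + 1) with h3 | h3
        · exact A.at_of_gt h3
        · exact A.at_of_lt (by omega)
    rw [h2] at h1
    exact_mod_cast h1
  · have e : ∀ r i, (chainOf A (r + 1) i : ℤ) - chainOf A r i = A.at (r + 1) (i + 1) := fun r i => by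
      rw [h.cast_chainOf_succ, add_sub_cancel_left]
    simp only [e, Pi.zero_apply, Nat.cast_zero, zero_add]
    have hnn : 0 ≤ ∑ q ∈ Finset.range j, A.at (r + 1) (q + 1) :=
      Finset.sum_nonneg fun _ _ => h.nonneg' _ _
    rcases lt_or_ge j (r + 1) with hj | hj
    · rw [Finset.sum_eq_zero]
      · exact hnn
      · exact fun q hq => A.at_of_lt (by rw [Finset.mem_range] at hq; omega)
    rcases lt_or_ge j n with hjn | hjn
    · exact h.yamanouchi (r + 1) j (by omega) hj hjn
    rcases lt_or_ge n (r + 2) with hr | hr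
    · rw [Finset.sum_eq_zero]
      · exact hnn
      · intro q hq
        rcases lt_or_ge n (q + 1) with h3 | h3
        · exact A.at_of_gt h3
        · exact A.at_of_lt (by omega)
    -- Columns beyond `n` contribute nothing to row `r + 2`, so the condition at `n - 1` gives all
    -- later ones.
    · have h1 := h.yamanouchi (r + 1) (n - 1) (by omega) (by omega) (by omega)
      rw [Nat.sub_add_cancel (by omega)] at h1
      have h2 : ∑ q ∈ Finset.range n, A.at (r + 2) (q + 1) =
          ∑ q ∈ Finset.range (j + 1), A.at (r + 2) (q + 1) :=
        Finset.sum_subset (by simp; omega) fun q _ hq => A.at_of_gt (by simp at hq; omega)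
      rw [← h2]
      exact h1.trans (Finset.sum_le_sum_of_subset_of_nonneg (by simp; omega)
        fun _ _ _ => h.nonneg' _ _)

theorem chainOf_last (h : IsIntegralLR lam μ ν A) (hlam : lam.colLen 0 ≤ n) :
    chainOf A n = lam.rowLen := by
  funext i
  rcases lt_or_ge i n with hi | hi
  · exact h.chainOf_of_lt hlam hi
  · rw [chainOf_of_le hi, rowLen_eq_zero hlam hi]

theorem triangleOf_chainOf (h : IsIntegralLR lam μ ν A) : triangleOf n (chainOf A) = A := by
  funext ⟨⟨i, j⟩, hij, hj⟩
  simp only at hij hj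
  simp only [triangleOf]
  rw [← A.at_of_le hij hj]
  split_ifs with h1 h2
  · rw [h1, h2, h.apex]
  · rw [h.cast_chainOf, zero_add, Finset.sum_range_one, Nat.sub_add_cancel (by omega), h1]
  · obtain ⟨i, rfl⟩ : ∃ k, i = k + 1 := ⟨i - 1, by omega⟩
    obtain ⟨j, rfl⟩ : ∃ k, j = k + 1 := ⟨j - 1, by omega⟩
    rw [Nat.add_sub_cancel, Nat.add_sub_cancel, h.cast_chainOf_succ]
    ring

end IsIntegralLR

/-! ### From chains to integral triangles -/

section OfChain

variable {lam μ ν : YoungDiagram} {c : ℕ → ℕ → ℕ}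

theorem triangleOf_at_zero (hc : ∀ i, n ≤ i → c 0 i = 0) (i : ℕ) :
    (triangleOf n c).at 0 (i + 1) = c 0 i := by
  rcases lt_or_ge i n with hi | hi
  · rw [Triangle.at_of_le _ (Nat.zero_le _) hi]
    simp [triangleOf]
  · rw [Triangle.at_of_gt _ (by omega), hc i hi, Nat.cast_zero]

theorem triangleOf_apex (c : ℕ → ℕ → ℕ) : (triangleOf n c).at 0 0 = 0 := by
  rw [Triangle.at_of_le _ le_rfl (Nat.zero_le _)]
  simp [triangleOf]

/-- The zero convention for column index less than row index is correct here: by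
`IsChain.apply_succ_eq`, strip `r` has no boxes above row `r`. -/
theorem triangleOf_at_succ (h : IsChain (n + n) μ.rowLen ν.rowLen 0 c)
    (hc : ∀ r i, n ≤ i → c r i = 0) (r i : ℕ) :
    (triangleOf n c).at (r + 1) (i + 1) = (c (r + 1) i : ℤ) - c r i := by
  rcases lt_or_ge i n with hi | hi
  · rcases lt_or_ge i r with hr | hr
    · rw [Triangle.at_of_lt _ (by omega), h.apply_succ_eq hr, sub_self]
    · rw [Triangle.at_of_le _ (by omega) hi]
      simp [triangleOf]
  · rw [Triangle.at_of_gt _ (by omega), hc _ i hi, hc _ i hi, sub_self]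

theorem sum_triangleOf_at (h : IsChain (n + n) μ.rowLen ν.rowLen 0 c)
    (hc : ∀ r i, n ≤ i → c r i = 0) (r i : ℕ) :
    ∑ p ∈ Finset.range (r + 1), (triangleOf n c).at p (i + 1) = c r i := by
  induction r with
  | zero => rw [zero_add, Finset.sum_range_one, triangleOf_at_zero (hc 0)]
  | succ r ih =>
    rw [Finset.sum_range_succ, ih, triangleOf_at_succ h hc]
    ring

theorem chainOf_triangleOf (h : IsChain (n + n) μ.rowLen ν.rowLen 0 c)
    (hc : ∀ r i, n ≤ i → c r i = 0) : chainOf (triangleOf n c) = c := by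
  funext r i
  rw [chainOf, sum_triangleOf_at h hc, Int.toNat_natCast]

theorem IsChain.apply_eq_zero (h : IsChain (n + n) μ.rowLen ν.rowLen 0 c) (hlam : lam.colLen 0 ≤ n)
    (hν : ν.colLen 0 ≤ n) (hl : c n = lam.rowLen) (r i : ℕ) (hi : n ≤ i) : c r i = 0 := by
  have h1 : c n i = 0 := by rw [hl, rowLen_eq_zero hlam hi]
  rcases le_total r n with hr | hr
  · exact Nat.le_zero.1 (h1 ▸ h.mono hr i)
  · rw [h.eq_of_le (fun i hi => rowLen_eq_zero hν hi) r hr, h1]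

theorem isIntegralLR_triangleOf (h : IsChain (n + n) μ.rowLen ν.rowLen 0 c)
    (hlam : lam.colLen 0 ≤ n) (hν : ν.colLen 0 ≤ n) (hl : c n = lam.rowLen) :
    IsIntegralLR lam μ ν (triangleOf n c) := by
  have hc := fun r i hi => h.apply_eq_zero hlam hν hl r i hi
  have hsucc := triangleOf_at_succ h hc
  refine ⟨triangleOf_apex c, fun i j hi hij hj => ?_, fun i j hi hij hj => ?_,
    fun i j hi hij hj => ?_, fun j hj hjn => ?_, fun j hj hjn => ?_, fun i hi hin => ?_⟩
  · obtain ⟨i, rfl⟩ : ∃ k, i = k + 1 := ⟨i - 1, by omega⟩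
    obtain ⟨j, rfl⟩ : ∃ k, j = k + 1 := ⟨j - 1, by omega⟩
    rw [hsucc]
    have := (h.strip i j).1
    omega
  · obtain ⟨i, rfl⟩ : ∃ k, i = k + 1 := ⟨i - 1, by omega⟩
    obtain ⟨j, rfl⟩ : ∃ k, j = k + 1 := ⟨j - 1, by omega⟩
    rw [sum_triangleOf_at h hc, sum_triangleOf_at h hc]
    exact_mod_cast (h.strip i j).2
  · obtain ⟨i, rfl⟩ : ∃ k, i = k + 1 := ⟨i - 1, by omega⟩
    simp only [hsucc]
    simpa using h.yam i j (by omega)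
  · obtain ⟨j, rfl⟩ : ∃ k, j = k + 1 := ⟨j - 1, by omega⟩
    rw [sum_triangleOf_at h hc, part, Nat.add_sub_cancel, ← hl]
    -- Row `j` is final after step `j + 1`, so it can be compared with the last shape.
    have h1 : ∀ r, j + 1 ≤ r → c r j = c (j + 1) j := by
      intro r hr
      induction r, hr using Nat.le_induction with
      | base => rfl
      | succ r hr ih => rw [h.apply_succ_eq (by omega), ih]
    rw [h1 n hjn]
  · obtain ⟨j, rfl⟩ : ∃ k, j = k + 1 := ⟨j - 1, by omega⟩
    rw [triangleOf_at_zero (hc 0), part, Nat.add_sub_cancel, h.start]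
  · obtain ⟨i, rfl⟩ : ∃ k, i = k + 1 := ⟨i - 1, by omega⟩
    simp only [hsucc]
    have h1 := h.size_eq i
    rw [← size_eq_size (hc _) (h.zero _), ← size_eq_size (hc _) (h.zero _)] at h1
    rw [part, Nat.add_sub_cancel, Finset.sum_sub_distrib]
    simp only [size] at h1
    have h2 := congrArg (Nat.cast : ℕ → ℤ) h1
    push_cast at h2
    linarith

/-- The exponent of the sign of a chain in terms of its triangle. -/
theorem cast_chainExp (h : IsChain (n + n) μ.rowLen ν.rowLen 0 c)
    (hlam : lam.colLen 0 ≤ n) (hμ : μ.colLen 0 ≤ n) (hν : ν.colLen 0 ≤ n) (hl : c n = lam.rowLen) :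
    (chainExp (n + n) n c : ℤ) = Qtri (triangleOf n c) + directNorthCount lam - directNorthCount μ := by
  have hc := fun r i hi => h.apply_eq_zero hlam hν hl r i hi
  have hsucc := triangleOf_at_succ h hc
  have h1 : Qtri (triangleOf n c) = ∑ r ∈ Finset.range n, ∑ i ∈ Finset.range n,
      ((c (r + 1) i : ℤ) - c r i) * ∑ p ∈ Finset.range i, (c r p : ℤ) := by
    rw [Qtri, Finset.sum_range_succ']
    simp only [Finset.range_zero, Finset.sum_empty, mul_zero, Finset.sum_const_zero, add_zero]
    refine Finset.sum_congr rfl fun r _ => ?_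
    rw [sum_Icc_eq_sum_range]
    · refine Finset.sum_congr rfl fun i _ => ?_
      rw [hsucc]
      congr 1
      have e : ∀ p, Finset.Ico p (i + 1) = Finset.Icc p i := fun p => by
        ext q
        simp
      simp only [e, Triangle.sum_Icc_eq _ (triangleOf_apex c)]
      rw [Finset.sum_comm]
      exact Finset.sum_congr rfl fun q _ => sum_triangleOf_at h hc r q
    · rw [Triangle.at_of_lt _ (Nat.succ_pos r), zero_mul]
    · intro q hq
      rw [Triangle.at_of_lt _ hq, zero_mul]
  have h2 : (chainExp (n + n) n c : ℤ) = ∑ r ∈ Finset.range n, ∑ i ∈ Finset.range n,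
      ((c (r + 1) i : ℤ) - c r i) * ((∑ p ∈ Finset.range i, (c r p : ℤ)) + i) := by
    rw [chainExp, Nat.cast_sum]
    refine Finset.sum_congr rfl fun r _ => ?_
    rw [insExp, ← Finset.sum_subset (s₁ := Finset.range n) (by simp)]
    · rw [Nat.cast_sum]
      refine Finset.sum_congr rfl fun i _ => ?_
      rw [Nat.cast_mul, Nat.cast_sub (h.strip r i).1]
      simp [Finset.sum_add_distrib]
    · intro i _ hi
      rw [hc _ i (by simpa using hi), Nat.zero_sub, zero_mul]
  -- The `+ 1` in `insExp` weights each added box by its row index. Summing over the strips first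
  -- telescopes from `μ` to `lam`.
  have h3 : ∑ r ∈ Finset.range n, ∑ i ∈ Finset.range n, ((c (r + 1) i : ℤ) - c r i) * i =
      (directNorthCount lam : ℤ) - directNorthCount μ := by
    rw [Finset.sum_comm, directNorthCount_eq lam hlam, directNorthCount_eq μ hμ, Nat.cast_sum,
      Nat.cast_sum, ← Finset.sum_sub_distrib]
    refine Finset.sum_congr rfl fun i _ => ?_
    rw [← Finset.sum_mul, Finset.sum_range_sub (fun r => (c r i : ℤ)), hl, h.start]
    push_cast
    ring
  rw [h2, h1]
  simp only [mul_add, Finset.sum_add_distrib]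
  rw [h3]
  ring

end OfChain

end Triangles

/-! ### The formula over triangles -/

section Formula

variable {n : ℕ} {lam μ ν : YoungDiagram}

open Classical in
/-- The chains from `μ` to `lam` of weight `ν`. -/
noncomputable def chainsTo (n : ℕ) (lam μ ν : YoungDiagram) : Finset (ℕ → ℕ → ℕ) :=
  {c ∈ chains (n + n) n μ.rowLen ν.rowLen 0 | c n = lam.rowLen}

theorem mem_chainsTo (hν : ν.colLen 0 ≤ n) {c : ℕ → ℕ → ℕ} :
    c ∈ chainsTo n lam μ ν ↔ IsChain (n + n) μ.rowLen ν.rowLen 0 c ∧ c n = lam.rowLen := by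
  classical
  rw [chainsTo, Finset.mem_filter, mem_chains fun i hi => rowLen_eq_zero hν hi]

theorem bijOn_triangleOf (hlam : lam.colLen 0 ≤ n) (hμ : μ.colLen 0 ≤ n) (hν : ν.colLen 0 ≤ n) :
    Set.BijOn (triangleOf n) (chainsTo n lam μ ν) (integerPoints (lrPolytope n lam μ ν)) := by
  refine ⟨fun c hc => ?_, fun c hc c' hc' heq => ?_, fun A hA => ?_⟩
  · rw [Finset.mem_coe, mem_chainsTo hν] at hc
    exact mem_integerPoints_lrPolytope.2 (isIntegralLR_triangleOf hc.1 hlam hν hc.2)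
  · rw [Finset.mem_coe, mem_chainsTo hν] at hc hc'
    rw [← chainOf_triangleOf hc.1 (hc.1.apply_eq_zero hlam hν hc.2), heq,
      chainOf_triangleOf hc'.1 (hc'.1.apply_eq_zero hlam hν hc'.2)]
  · rw [mem_integerPoints_lrPolytope] at hA
    refine ⟨chainOf A, ?_, hA.triangleOf_chainOf⟩
    rw [Finset.mem_coe, mem_chainsTo hν]
    exact ⟨hA.isChain hlam hμ hν, hA.chainOf_last hlam⟩

theorem finite_integerPoints_lrPolytope (hlam : lam.colLen 0 ≤ n) (hμ : μ.colLen 0 ≤ n)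
    (hν : ν.colLen 0 ≤ n) : (integerPoints (lrPolytope n lam μ ν)).Finite := by
  rw [← (bijOn_triangleOf hlam hμ hν).image_eq]
  exact (Finset.finite_toSet _).image _

theorem negOnePow_natCast (a : ℕ) : ((a : ℤ).negOnePow : ℤ) = (-1) ^ a := by
  simp [Int.negOnePow]

theorem oddLRCoeff_eq_sum_Qtri (hlam : lam.colLen 0 ≤ n) (hμ : μ.colLen 0 ≤ n)
    (hν : ν.colLen 0 ≤ n) :
    oddLRCoeff μ ν lam = (-1) ^ (northCount μ + northCount lam) *
      ∑ᶠ A ∈ integerPoints (lrPolytope n lam μ ν), ((Qtri A).negOnePow : ℤ) := by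
  rw [← finsum_mem_eq_of_bijOn (f := fun c => ((Qtri (triangleOf n c)).negOnePow : ℤ))
    (triangleOf n) (bijOn_triangleOf hlam hμ hν) fun _ _ => rfl, finsum_mem_coe_finset,
    oddLRCoeff_eq n lam μ ν hμ hν, Finset.mul_sum]
  refine Finset.sum_congr rfl fun c hc => ?_
  have hc' : c ∈ chainsTo n lam μ ν := hc
  rw [mem_chainsTo hν] at hc'
  have h1 := cast_chainExp hc'.1 hlam hμ hν hc'.2
  rw [← negOnePow_natCast, ← negOnePow_natCast, ← Units.val_mul, ← Int.negOnePow_add]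
  congr 1
  rw [Int.negOnePow_eq_iff]
  push_cast
  rw [h1]
  -- The count for `μ` cancels, and the one for `lam` occurs twice.
  exact ⟨directNorthCount lam, by ring⟩

end Formula

/-! ### Hives -/

section Hives

variable {n : ℕ} {R : Type*} [CommRing R]

theorem triangleToHive_at (A : Triangle n R) {i j : ℕ} (hij : i ≤ j) (hj : j ≤ n) :
    (triangleToHive A).at i j =
      ∑ p ∈ Finset.range (i + 1), ∑ q ∈ Finset.Icc p j, A.at p q := by
  rw [Triangle.at_of_le _ hij hj, triangleToHive]

theorem triangleToHive_sub_left (A : Triangle n R) {i j : ℕ} (hij : i + 1 ≤ j) (hj : j ≤ n) :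
    (triangleToHive A).at (i + 1) j - (triangleToHive A).at i j =
      ∑ q ∈ Finset.Icc (i + 1) j, A.at (i + 1) q := by
  rw [triangleToHive_at A hij hj, triangleToHive_at A (by omega) hj, Finset.sum_range_succ _ (i + 1)]
  ring

theorem sum_Icc_succ_eq (A : Triangle n R) {p j : ℕ} (hp : p ≤ j + 1) :
    ∑ q ∈ Finset.Icc p (j + 1), A.at p q = ∑ q ∈ Finset.Icc p j, A.at p q + A.at p (j + 1) :=
  Finset.sum_Icc_succ_top hp _

theorem triangleToHive_sub_right (A : Triangle n R) {i j : ℕ} (hij : i ≤ j) (hj : j + 1 ≤ n) :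
    (triangleToHive A).at i (j + 1) - (triangleToHive A).at i j =
      ∑ p ∈ Finset.range (i + 1), A.at p (j + 1) := by
  rw [triangleToHive_at A (by omega) hj, triangleToHive_at A hij (by omega),
    ← Finset.sum_sub_distrib]
  refine Finset.sum_congr rfl fun p hp => ?_
  rw [Finset.mem_range] at hp
  rw [sum_Icc_succ_eq A (by omega), add_sub_cancel_left]

theorem triangleToHive_sub_diag (A : Triangle n R) {j : ℕ} (hj : j + 1 ≤ n) :
    (triangleToHive A).at (j + 1) (j + 1) - (triangleToHive A).at j j =
      ∑ p ∈ Finset.range (j + 2), A.at p (j + 1) := by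
  have h1 := triangleToHive_sub_left A le_rfl hj
  have h2 := triangleToHive_sub_right A (le_refl j) hj
  rw [Finset.Icc_self, Finset.sum_singleton] at h1
  rw [Finset.sum_range_succ, ← h1, ← h2]
  ring

theorem triangleToHive_apex (A : Triangle n R) : (triangleToHive A).at 0 0 = A.at 0 0 := by
  rw [triangleToHive_at A le_rfl (Nat.zero_le n)]
  simp

theorem triangleToHive_injective : Function.Injective (triangleToHive : Triangle n R → _) := by
  intro A B h
  have key : ∀ i j, i ≤ j → j ≤ n → A.at i j = B.at i j := by
    have hrow : ∀ i j, i + 1 ≤ j → j ≤ n → ∑ q ∈ Finset.Icc (i + 1) j, A.at (i + 1) q =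
        ∑ q ∈ Finset.Icc (i + 1) j, B.at (i + 1) q := fun i j hij hj => by
      rw [← triangleToHive_sub_left A hij hj, h, triangleToHive_sub_left B hij hj]
    have hrow' : ∀ i j, i ≤ j → j ≤ n → ∑ q ∈ Finset.Icc i j, A.at i q =
        ∑ q ∈ Finset.Icc i j, B.at i q := by
      intro i j hij hj
      cases i with
      | zero =>
        have h1 := triangleToHive_at A hij hj
        have h2 := triangleToHive_at B hij hj
        rw [zero_add, Finset.sum_range_one] at h1 h2
        rw [← h1, ← h2, h]
      | succ i => exact hrow i j hij hj
    intro i j hij hj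
    rcases hij.eq_or_lt with rfl | hlt
    · simpa using hrow' i i le_rfl hj
    · obtain ⟨k, rfl⟩ : ∃ k, j = k + 1 := ⟨j - 1, by omega⟩
      have h1 := hrow' i (k + 1) hij hj
      rw [sum_Icc_succ_eq A hij, sum_Icc_succ_eq B hij, hrow' i k (by omega) (by omega)] at h1
      exact add_left_cancel h1
  funext ⟨⟨i, j⟩, hij, hj⟩
  have := key i j hij hj
  rwa [A.at_of_le hij hj, B.at_of_le hij hj] at this

/-- The sums `∑_{q ≤ j} a_{i,q}` of the rows of the triangle of a hive. -/
def hiveRow (H : Triangle n R) (i j : ℕ) : R :=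
  if i = 0 then H.at 0 j else H.at i j - H.at (i - 1) j

/-- The inverse of `triangleToHive`. -/
def hiveToTriangle (H : Triangle n R) : Triangle n R := fun x =>
  hiveRow H x.1.1 x.1.2 - if x.1.1 = x.1.2 then 0 else hiveRow H x.1.1 (x.1.2 - 1)

theorem sum_hiveToTriangle (H : Triangle n R) {i j : ℕ} (hij : i ≤ j) (hj : j ≤ n) :
    ∑ q ∈ Finset.Icc i j, (hiveToTriangle H).at i q = hiveRow H i j := by
  induction j, hij using Nat.le_induction with
  | base =>
    rw [Finset.Icc_self, Finset.sum_singleton, Triangle.at_of_le _ le_rfl hj]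
    simp [hiveToTriangle]
  | succ j hij ih =>
    rw [sum_Icc_succ_eq _ (by omega), ih (by omega), Triangle.at_of_le _ (by omega) hj]
    simp only [hiveToTriangle]
    rw [if_neg (by omega), Nat.add_sub_cancel]
    ring

theorem triangleToHive_hiveToTriangle (H : Triangle n R) :
    triangleToHive (hiveToTriangle H) = H := by
  funext ⟨⟨i, j⟩, hij, hj⟩
  simp only at hij hj
  rw [← Triangle.at_of_le (triangleToHive _) hij hj, ← Triangle.at_of_le H hij hj, triangleToHive_at _ hij hj]
  have key : ∀ k ≤ j, ∑ p ∈ Finset.range (k + 1), ∑ q ∈ Finset.Icc p j, (hiveToTriangle H).at p q =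
      H.at k j := by
    intro k hk
    induction k with
    | zero =>
      rw [zero_add, Finset.sum_range_one, sum_hiveToTriangle H hk hj]
      simp [hiveRow]
    | succ k ih =>
      rw [Finset.sum_range_succ, ih (by omega), sum_hiveToTriangle H hk hj]
      simp [hiveRow]
  exact key i hij

theorem sum_Icc_shift {g : ℕ → R} (h : g 0 = 0) (m : ℕ) :
    ∑ i ∈ Finset.Icc 1 m, g (i - 1) = ∑ i ∈ Finset.Icc 1 (m - 1), g i := by
  cases m with
  | zero => simp
  | succ m =>
    induction m with
    | zero => simp [h]
    | succ m ih =>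
      rw [Finset.sum_Icc_succ_top (by omega), ih, Nat.add_sub_cancel, Nat.add_sub_cancel,
        Finset.sum_Icc_succ_top (by omega)]

/-- `triangleToHive` preserves the quadratic forms. -/
theorem Qhive_triangleToHive (A : Triangle n R) (h0 : A.at 0 0 = 0) :
    Qhive (triangleToHive A) = Qtri A := by
  have hQ : Qtri A = ∑ i ∈ Finset.Icc 1 n, ∑ j ∈ Finset.Icc i n,
      A.at i j * (triangleToHive A).at (i - 1) (j - 1) := by
    rw [Qtri, Finset.sum_range_succ']
    simp only [Finset.range_zero, Finset.sum_empty, mul_zero, Finset.sum_const_zero, add_zero]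
    rw [Finset.range_eq_Ico, Finset.sum_Ico_add' (fun i => ∑ j ∈ Finset.Icc i n, A.at i j *
      ∑ p ∈ Finset.range i, ∑ q ∈ Finset.Ico p j, A.at p q) 0 n 1]
    refine Finset.sum_congr (by ext; simp) fun i hi => Finset.sum_congr rfl fun j hj => ?_
    rw [Finset.mem_Icc] at hi hj
    obtain ⟨i, rfl⟩ : ∃ k, i = k + 1 := ⟨i - 1, by omega⟩
    obtain ⟨j, rfl⟩ : ∃ k, j = k + 1 := ⟨j - 1, by omega⟩
    rw [Nat.add_sub_cancel, Nat.add_sub_cancel, triangleToHive_at A (by omega) (by omega)]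
    have e : ∀ p, Finset.Ico p (j + 1) = Finset.Icc p j := fun p => by
      ext q
      simp
    simp only [e]
  set H := triangleToHive A with hH
  -- Off the diagonal the mixed difference of partial sums is `A.at i j`. On the diagonal `H.at i (i
  -- - 1)` is read as `0`, which leaves an extra `H.at (i - 1) (i - 1)` and hence the square.
  have hterm : ∀ i ∈ Finset.Icc 1 n, ∑ j ∈ Finset.Icc i n, H.at (i - 1) (j - 1) *
      (H.at i j - H.at (i - 1) j - H.at i (j - 1) + H.at (i - 1) (j - 1)) =
      ∑ j ∈ Finset.Icc i n, A.at i j * H.at (i - 1) (j - 1) + H.at (i - 1) (i - 1) ^ 2 := by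
    intro i hi
    rw [Finset.mem_Icc] at hi
    obtain ⟨i, rfl⟩ : ∃ k, i = k + 1 := ⟨i - 1, by omega⟩
    have e : H.at i i ^ 2 = ∑ j ∈ Finset.Icc (i + 1) n, if j = i + 1 then H.at i i ^ 2 else 0 := by
      rw [Finset.sum_ite_eq', if_pos (Finset.mem_Icc.2 ⟨le_rfl, hi.2⟩)]
    rw [Nat.add_sub_cancel, e, ← Finset.sum_add_distrib]
    refine Finset.sum_congr rfl fun j hj => ?_
    rw [Finset.mem_Icc] at hj
    obtain ⟨j, rfl⟩ : ∃ k, j = k + 1 := ⟨j - 1, by omega⟩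
    have h1 := triangleToHive_sub_left A hj.1 hj.2
    rw [Nat.add_sub_cancel]
    split_ifs with hij
    · obtain rfl : j = i := by omega
      rw [Finset.Icc_self, Finset.sum_singleton] at h1
      rw [← h1, H.at_of_lt (Nat.lt_succ_self j)]
      ring
    · have h2 := triangleToHive_sub_left A (show i + 1 ≤ j by omega) (show j ≤ n by omega)
      rw [sum_Icc_succ_eq A hj.1, ← h2] at h1
      linear_combination H.at i j * h1
  rw [Qhive, hQ, Finset.sum_congr rfl hterm, Finset.sum_add_distrib, add_sub_assoc]
  have hdiag : ∑ i ∈ Finset.Icc 1 n, H.at (i - 1) (i - 1) ^ 2 =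
      ∑ i ∈ Finset.Icc 1 (n - 1), H.at i i ^ 2 := by
    refine sum_Icc_shift (g := fun i => H.at i i ^ 2) ?_ n
    rw [hH, triangleToHive_apex, h0, zero_pow two_ne_zero]
  rw [hdiag, sub_self, add_zero]

/-- Differences of neighbouring hive entries are partial row or column sums of the triangle, so the
defining conditions correspond one by one. -/
theorem triangleToHive_mem_iff (lam μ ν : YoungDiagram) (A : Triangle n ℝ) :
    triangleToHive A ∈ hivePolytope n lam μ ν ↔ A ∈ lrPolytope n lam μ ν := by
  have hapex := triangleToHive_apex A
  have hright : ∀ i j, 1 ≤ i → i < j → j ≤ n →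
      ((triangleToHive A).at (i - 1) j - (triangleToHive A).at (i - 1) (j - 1) ≤
        (triangleToHive A).at i j - (triangleToHive A).at i (j - 1) ↔ 0 ≤ A.at i j) := by
    intro i j hi hij hj
    obtain ⟨i, rfl⟩ : ∃ k, i = k + 1 := ⟨i - 1, by omega⟩
    obtain ⟨j, rfl⟩ : ∃ k, j = k + 1 := ⟨j - 1, by omega⟩
    rw [Nat.add_sub_cancel, Nat.add_sub_cancel, triangleToHive_sub_right A (by omega) hj,
      triangleToHive_sub_right A (by omega) hj, Finset.sum_range_succ _ (i + 1)]
    exact le_add_iff_nonneg_right _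
  have hvert : ∀ i j, 1 ≤ i → i ≤ j → j < n →
      ((triangleToHive A).at i (j + 1) - (triangleToHive A).at i j ≤
        (triangleToHive A).at (i - 1) j - (triangleToHive A).at (i - 1) (j - 1) ↔
      ∑ p ∈ Finset.range (i + 1), A.at p (j + 1) ≤ ∑ p ∈ Finset.range i, A.at p j) := by
    intro i j hi hij hj
    obtain ⟨i, rfl⟩ : ∃ k, i = k + 1 := ⟨i - 1, by omega⟩
    obtain ⟨j, rfl⟩ : ∃ k, j = k + 1 := ⟨j - 1, by omega⟩
    rw [Nat.add_sub_cancel, Nat.add_sub_cancel, triangleToHive_sub_right A hij hj,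
      triangleToHive_sub_right A (by omega) (by omega)]
  have hleft : ∀ i j, 1 ≤ i → i ≤ j → j < n →
      ((triangleToHive A).at (i + 1) (j + 1) - (triangleToHive A).at i (j + 1) ≤
        (triangleToHive A).at i j - (triangleToHive A).at (i - 1) j ↔
      ∑ q ∈ Finset.Icc (i + 1) (j + 1), A.at (i + 1) q ≤ ∑ q ∈ Finset.Icc i j, A.at i q) := by
    intro i j hi hij hj
    obtain ⟨i, rfl⟩ : ∃ k, i = k + 1 := ⟨i - 1, by omega⟩
    rw [Nat.add_sub_cancel, triangleToHive_sub_left A (by omega) hj,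
      triangleToHive_sub_left A hij (by omega)]
  have hlam : ∀ j, 1 ≤ j → j ≤ n → (triangleToHive A).at j j - (triangleToHive A).at (j - 1) (j - 1) =
      ∑ p ∈ Finset.range (j + 1), A.at p j := by
    intro j hj hjn
    obtain ⟨j, rfl⟩ : ∃ k, j = k + 1 := ⟨j - 1, by omega⟩
    exact triangleToHive_sub_diag A hjn
  have hmu : ∀ j, 1 ≤ j → j ≤ n → (triangleToHive A).at 0 j - (triangleToHive A).at 0 (j - 1) =
      A.at 0 j := by
    intro j hj hjn
    obtain ⟨j, rfl⟩ : ∃ k, j = k + 1 := ⟨j - 1, by omega⟩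
    rw [Nat.add_sub_cancel, triangleToHive_sub_right A (Nat.zero_le _) hjn, zero_add,
      Finset.sum_range_one]
  have hnu : ∀ i, 1 ≤ i → i ≤ n → (triangleToHive A).at i n - (triangleToHive A).at (i - 1) n =
      ∑ q ∈ Finset.Icc i n, A.at i q := by
    intro i hi hin
    obtain ⟨i, rfl⟩ : ∃ k, i = k + 1 := ⟨i - 1, by omega⟩
    exact triangleToHive_sub_left A hin le_rfl
  constructor
  · rintro ⟨⟨h1, h2, h3, h4⟩, h5, h6, h7⟩
    exact ⟨⟨hapex ▸ h1, fun i j a b c => (hright i j a b c).1 (h2 i j a b c),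
      fun i j a b c => (hvert i j a b c).1 (h3 i j a b c),
      fun i j a b c => (hleft i j a b c).1 (h4 i j a b c)⟩,
      fun j a b => (h5 j a b).trans (hlam j a b), fun j a b => (h6 j a b).trans (hmu j a b),
      fun i a b => (h7 i a b).trans (hnu i a b)⟩
  · rintro ⟨⟨h1, h2, h3, h4⟩, h5, h6, h7⟩
    exact ⟨⟨hapex.trans h1, fun i j a b c => (hright i j a b c).2 (h2 i j a b c),
      fun i j a b c => (hvert i j a b c).2 (h3 i j a b c),
      fun i j a b c => (hleft i j a b c).2 (h4 i j a b c)⟩,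
      fun j a b => (h5 j a b).trans (hlam j a b).symm,
      fun j a b => (h6 j a b).trans (hmu j a b).symm,
      fun i a b => (h7 i a b).trans (hnu i a b).symm⟩

theorem bijOn_triangleToHive (lam μ ν : YoungDiagram) :
    Set.BijOn triangleToHive (lrPolytope n lam μ ν) (hivePolytope n lam μ ν) := by
  refine ⟨fun A hA => (triangleToHive_mem_iff lam μ ν A).2 hA, triangleToHive_injective.injOn,
    fun H hH => ⟨hiveToTriangle H, ?_, triangleToHive_hiveToTriangle H⟩⟩
  rwa [← triangleToHive_mem_iff, triangleToHive_hiveToTriangle]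

theorem triangleToHive_cast (A : Triangle n ℤ) :
    (fun p => ((triangleToHive A p : ℤ) : ℝ)) = triangleToHive fun p => (A p : ℝ) := by
  funext p
  simp only [triangleToHive, Triangle.at_cast]
  push_cast
  rfl

theorem triangleToHive_mem_integerPoints_iff (lam μ ν : YoungDiagram) (A : Triangle n ℤ) :
    triangleToHive A ∈ integerPoints (hivePolytope n lam μ ν) ↔
      A ∈ integerPoints (lrPolytope n lam μ ν) := by
  rw [integerPoints, integerPoints, Set.mem_ofPred_eq, Set.mem_ofPred_eq, triangleToHive_cast,
    triangleToHive_mem_iff]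

/-- The inverse only takes differences, so it is defined over `ℤ` and integrality passes in both
directions. -/
theorem bijOn_triangleToHive_integerPoints (lam μ ν : YoungDiagram) :
    Set.BijOn triangleToHive (integerPoints (lrPolytope n lam μ ν))
      (integerPoints (hivePolytope n lam μ ν)) := by
  refine ⟨fun A hA => (triangleToHive_mem_integerPoints_iff lam μ ν A).2 hA,
    triangleToHive_injective.injOn,
    fun H hH => ⟨hiveToTriangle H, ?_, triangleToHive_hiveToTriangle H⟩⟩
  rwa [← triangleToHive_mem_integerPoints_iff, triangleToHive_hiveToTriangle]

end Hives

end OddLR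

/-! ### The theorem -/

open OddLR
theorem mainTheorem5 (n : ℕ) (hn : 1 ≤ n) (lam μ ν : YoungDiagram)
    (hlam : lam.colLen 0 ≤ n) (hμ : μ.colLen 0 ≤ n) (hν : ν.colLen 0 ≤ n) :
    -- the odd Littlewood–Richardson coefficients are well defined
    LinearIndependent ℤ oddSchur ∧
    oddSchur μ * oddSchur ν = Finsupp.linearCombination ℤ oddSchur (oddLRExpansion μ ν) ∧
    -- the formula over Littlewood–Richardson triangles
    (integerPoints (lrPolytope n lam μ ν)).Finite ∧
    oddLRCoeff μ ν lam = (-1) ^ (northCount μ + northCount lam) *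
      ∑ᶠ A ∈ integerPoints (lrPolytope n lam μ ν), ((Qtri A).negOnePow : ℤ) ∧
    -- the formula over hives
    (integerPoints (hivePolytope n lam μ ν)).Finite ∧
    oddLRCoeff μ ν lam = (-1) ^ (northCount μ + northCount lam) *
      ∑ᶠ H ∈ integerPoints (hivePolytope n lam μ ν), ((Qhive H).negOnePow : ℤ) ∧
    -- the two signed sums correspond to each other under the change of coordinates
    Set.BijOn triangleToHive (lrPolytope n lam μ ν) (hivePolytope n lam μ ν) ∧
    Set.BijOn triangleToHive (integerPoints (lrPolytope n lam μ ν))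
      (integerPoints (hivePolytope n lam μ ν)) ∧
    (∀ A : Triangle n ℝ, A.at 0 0 = 0 → Qhive (triangleToHive A) = Qtri A) := by
  have hfin := finite_integerPoints_lrPolytope hlam hμ hν
  have hcoeff := oddLRCoeff_eq_sum_Qtri hlam hμ hν
  have hbij := bijOn_triangleToHive_integerPoints (n := n) lam μ ν
  refine ⟨linearIndependent_oddSchur, oddSchur_mul_eq_linearCombination n μ ν hμ hν, hfin, hcoeff,
    ?_, ?_, bijOn_triangleToHive lam μ ν, hbij, Qhive_triangleToHive⟩
  · rw [← hbij.image_eq]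
    exact hfin.image _
  · rw [hcoeff]
    congr 1
    refine finsum_mem_eq_of_bijOn triangleToHive hbij fun A hA => ?_
    rw [Qhive_triangleToHive A (mem_integerPoints_lrPolytope.1 hA).apex]
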